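/- All graphs are finite and simple. $c(H)$ denotes the number of components of a graph $H$, and $d_H(v)$ the degree of $v$ in $H$. For a set $F=\{u,v\}$ of two vertices of a graph $G$, let $c(G,F)=c(G,uv)$ be the number of components of $G-F$ that contain a neighbour of $u$ and a neighbour of $v$; $F$ is a \emph{nontrivial 2-cut} (N2C) of $G$ if $c(G,F)\ge 3$. A block of $G$ is a maximal connected subgraph without a cutvertex of its own. The block-cutvertex tree of a connected graph $G$ has the blocks and the cutvertices of $G$ as its vertices, a cutvertex being adjacent to the blocks that contain it. If this tree is rooted at a block $B_0$, then the \emph{root vertex} of a block $B\ne B_0$ is its parent, i.e. the cutvertex that precedes $B$ on the path from $B_0$ to $B$. **Theorem.** Let $G$ be a connected $K_4$-minor-free graph with $|V(G)|\ge 2$, let $\mathcal F$ be the set of all N2Cs of $G$, and for $v\in V(G)$ let $\mathcal F(v)=\{F\in\mathcal F : v\in F\}$. Suppose there are an integer $f(v)\ge 2$ for each $v\in V(G)$ and a nonnegative integer function $\omega$ on the ordered pairs $(F,u)$ with $F\in\mathcal F$, $u\in F$, such that $$\omega(F,u)+\omega(F,v)=c(G,F)-2\quad\text{for all } F=\{u,v\}\in\mathcal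 F,$$ $$\sum_{F\in\mathcal F(u)}\omega(F,u)+c(G-u)-1\le f(u)-2\quad\text{for all } u\in V(G).$$ Choose a root edge $r_0s_0\in E(G)$ with $c(G,r_0s_0)\le 1$. Let the (distinct) blocks of $G$ be $B_0,B_1,\dots,B_k$, where $r_0s_0\in E(B_0)$, and root the block-cutvertex tree of $G$ at $B_0$. For each $i=1,\dots,k$ let $r_i$ be the root vertex of $B_i$, and choose $r_is_i\in E(B_i)$ with $c(G,r_is_i)\le 1$. Then $G$ has a spanning tree $T$ such that $d_T(v)\le f(v)$ for all $v\in V(G)$, and $d_T(v)\le f(v)-1$ for all $v\in\{r_0\}\cup\{s_0,s_1,\dots,s_k\}$. Furthermore, for $0\le i\le k$, $r_is_i\in E(T)$ if $c(G,r_is_i)=0$, and $r_is_i\notin E(T)$ if $c(G,r_is_i)=1$. -/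

import Mathlib

namespace SimpleGraph

variable {V : Type*}

/-- `H` is a minor of `G`: there are pairwise disjoint connected (hence nonempty) branch sets
in `G`, one for each vertex of `H`, with an edge of `G` between the branch sets of any two
adjacent vertices of `H`. -/
def HasMinor {W : Type*} (G : SimpleGraph V) (H : SimpleGraph W) : Prop :=
  ∃ φ : W → Set V,
    (∀ a, (G.induce (φ a)).Connected) ∧
    (∀ a b, a ≠ b → Disjoint (φ a) (φ b)) ∧
    (∀ a b, H.Adj a b → ∃ x ∈ φ a, ∃ y ∈ φ b, G.Adj x y)

/-- `G` has no minor isomorphic to the complete graph on four vertices. -/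
def K4MinorFree (G : SimpleGraph V) : Prop :=
  ¬ G.HasMinor (⊤ : SimpleGraph (Fin 4))

/-- The graph `G - S`. -/
abbrev minusVerts (G : SimpleGraph V) (S : Set V) : SimpleGraph ↥(Sᶜ) :=
  G.induce Sᶜ

/-- The number `c(G)` of connected components. -/
noncomputable def numComponents (G : SimpleGraph V) : ℕ :=
  Nat.card G.ConnectedComponent

/-- The set of attachments in `S` of (the `S`-bridge consisting of) a component `C` of `G - S`
(and of all edges joining it to `S`): the vertices of `S` adjacent to some vertex of `C`. -/
def attachments (G : SimpleGraph V) (S : Set V)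
    (C : (G.minusVerts S).ConnectedComponent) : Set V :=
  {w | w ∈ S ∧ ∃ z : ↥(Sᶜ), z ∈ C.supp ∧ G.Adj w z}

/-- The number `c(G, F)` of nontrivial `F`-bridges of `G` that contain every vertex of `F`. -/
noncomputable def numFullBridges (G : SimpleGraph V) (F : Finset V) : ℕ :=
  Nat.card {C : (G.minusVerts (F : Set V)).ConnectedComponent //
    (F : Set V) ⊆ G.attachments (F : Set V) C}

/-- `F` is a nontrivial 2-cut (N2C) of `G`. -/
def IsN2C (G : SimpleGraph V) (F : Finset V) : Prop :=
  F.card = 2 ∧ 3 ≤ G.numFullBridges F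

open Classical in
/-- The set of all nontrivial 2-cuts of `G` that contain the vertex `u`. -/
noncomputable def n2csAt [Fintype V] (G : SimpleGraph V) (u : V) : Finset (Finset V) :=
  Finset.univ.filter (fun F => G.IsN2C F ∧ u ∈ F)

/-- `v` is a cutvertex of `G`: deleting it increases the number of components. -/
def IsCutvertex (G : SimpleGraph V) (v : V) : Prop :=
  G.numComponents < (G.minusVerts {v}).numComponents

/-- A block is a connected graph with no cutvertex. -/
def IsBlockGraph (G : SimpleGraph V) : Prop :=
  G.Connected ∧ ∀ v, ¬ G.IsCutvertex v

/-- A block of `G` is a maximal subgraph of `G` that is itself a block. -/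
def IsBlockOf (G : SimpleGraph V) (B : G.Subgraph) : Prop :=
  Maximal (fun H : G.Subgraph => H.coe.IsBlockGraph) B

/-- The type of blocks of `G`. -/
def BlockOf (G : SimpleGraph V) : Type _ :=
  {B : G.Subgraph // G.IsBlockOf B}

/-- The type of cutvertices of `G`. -/
def CutvertexOf (G : SimpleGraph V) : Type _ :=
  {v : V // G.IsCutvertex v}

/-- The block-cutvertex tree of `G`: a cutvertex is adjacent to the blocks that contain it. -/
def blockCutvertexTree (G : SimpleGraph V) : SimpleGraph (G.BlockOf ⊕ G.CutvertexOf) where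
  Adj
    | Sum.inl B, Sum.inr c => c.1 ∈ B.1.verts
    | Sum.inr c, Sum.inl B => c.1 ∈ B.1.verts
    | _, _ => False
  symm := ⟨by
    rintro (B | c) (B' | c') h <;> exact h⟩
  loopless := ⟨by
    rintro (B | c) h <;> exact h⟩

/-- `v` is the root vertex of the block `B` when the block-cutvertex tree is rooted at the block
`B₀`: it is the parent of `B`, i.e. the vertex preceding `B` on the path from `B₀` to `B`. -/
def IsRootVertex (G : SimpleGraph V) (B₀ B : G.BlockOf) (v : V) : Prop :=
  ∃ c : G.CutvertexOf, c.1 = v ∧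
    ∃ p : G.blockCutvertexTree.Walk (Sum.inl B₀) (Sum.inl B),
      p.IsPath ∧ p.penultimate = Sum.inr c

/-- The degree `d_T(v)`. -/
noncomputable def deg (T : SimpleGraph V) (v : V) : ℕ :=
  (T.neighborSet v).ncard

end SimpleGraph

namespace SimpleGraph

/-! The tree is assembled block by block. Suppose each block `B i` has a connected spanning subgraph
`T i` of degree at most 1 at `r i` and `s i` and at most 2 elsewhere, apart from the charges ω of
the N2Cs inside the block. The union of the `T i` is connected. Two vertices share at most one
block, so no charge is counted twice; a vertex `v` lies in at most c(G - v) blocks; and, since the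
block-cutvertex graph is acyclic, at most one of these is the root block or has a root vertex other
than `v`. So `v` has degree at most c(G - v) + 1 plus its charges, and the 1 is saved if `v` is `r
0` or some `s i`. The second hypothesis bounds this by f(v), respectively f(v) - 1, and any spanning
tree of the union works.

Within a block on `S`, the induction is over components `X` of G[S] - {u, v} ("pieces"). With 2
units of degree at each vertex of `X` and the charges of pairs other than {u, v}, one can either
join `X`, `u` and `v` together using one unit at each of `u`, `v`, or attach every vertex of `X` to
`u` or `v` using a single unit, at whichever end is preferred (`IsPiece.joins_and_covers`). Having
no K₄ minor yields a vertex `x` of `X` separating the neighbours of `u` from those of `v`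
(`K4MinorFree.exists_separator`, from Menger's theorem for two paths). This splits `X` into a region
between `u` and `x` and one between `x` and `v`, each a union of smaller pieces.

The charges are exactly what a region needs (`IsRegion.joins_and_covers`). Of the at most c(G, ux)
pieces at {u, x}, one contains `v` and lies outside the region. One further piece is joined, and
each of the remaining c(G, ux) - 2 costs one unit, paid by the charges of {u, x}. Since c(G, rs) ≤ 1
for a root edge rs, the rest of the block is empty or a single piece at {r, s}, which gives
`exists_block_subgraph`. -/

/-- `x` and `y` are joined by a walk of `G` all of whose vertices lie in `A`. -/
def ConnIn {V : Type*} (G : SimpleGraph V) (A : Set V) (x y : V) : Prop :=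
  ∃ p : G.Walk x y, ∀ z ∈ p.support, z ∈ A

/-! ### Connection inside a vertex set -/

namespace ConnIn

variable {V : Type*} {G : SimpleGraph V} {A C : Set V} {x y z : V}

theorem refl (h : x ∈ A) : G.ConnIn A x x := ⟨.nil, by simpa using h⟩

theorem left_mem (h : G.ConnIn A x y) : x ∈ A := by
  obtain ⟨p, hp⟩ := h
  exact hp _ p.start_mem_support

theorem right_mem (h : G.ConnIn A x y) : y ∈ A := by
  obtain ⟨p, hp⟩ := h
  exact hp _ p.end_mem_support

theorem symm (h : G.ConnIn A x y) : G.ConnIn A y x := by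
  obtain ⟨p, hp⟩ := h
  exact ⟨p.reverse, by simpa using hp⟩

theorem trans (h : G.ConnIn A x y) (h' : G.ConnIn A y z) : G.ConnIn A x z := by
  obtain ⟨p, hp⟩ := h
  obtain ⟨q, hq⟩ := h'
  refine ⟨p.append q, fun w hw => ?_⟩
  rcases (Walk.mem_support_append_iff p q).1 hw with h | h
  exacts [hp _ h, hq _ h]

theorem mono (h : G.ConnIn A x y) (hAC : A ⊆ C) : G.ConnIn C x y := by
  obtain ⟨p, hp⟩ := h
  exact ⟨p, fun w hw => hAC (hp _ hw)⟩

theorem of_adj (hx : x ∈ A) (hy : y ∈ A) (h : G.Adj x y) : G.ConnIn A x y :=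
  ⟨.cons h .nil, by simp [hx, hy]⟩

theorem of_mem_support {p : G.Walk x y} (hp : ∀ w ∈ p.support, w ∈ A) (hz : z ∈ p.support) :
    G.ConnIn A x z := by
  classical
  exact ⟨p.takeUntil z hz, fun w hw => hp _ (p.support_takeUntil_subset_support hz hw)⟩

theorem avoid_or (h : G.ConnIn A x y) (s : V) :
    G.ConnIn (A \ {s}) x y ∨ (G.ConnIn A x s ∧ G.ConnIn A s y) := by
  obtain ⟨p, hp⟩ := h
  by_cases hs : s ∈ p.support
  · refine .inr ⟨of_mem_support hp hs, ?_⟩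
    exact (of_mem_support (p := p.reverse) (by simpa using hp) (by simpa using hs)).symm
  · exact .inl ⟨p, fun w hw => ⟨hp _ hw, fun h => hs (h ▸ hw)⟩⟩

/-- A set closed under adjacency within `A` is closed under connection within `A`. -/
theorem closed {P : Set V} (h : G.ConnIn A x y) (hx : x ∈ P)
    (hP : ∀ a ∈ P, ∀ b ∈ A, G.Adj a b → b ∈ P) : y ∈ P := by
  obtain ⟨p, hp⟩ := h
  induction p with
  | nil => exact hx
  | cons hadj p ih =>
    refine ih (hP _ hx _ (hp _ (by simp)) hadj) fun w hw => hp _ (by simp [hw])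

theorem to_class (h : G.ConnIn A x y) : G.ConnIn {z | G.ConnIn A x z} x y := by
  obtain ⟨p, hp⟩ := h
  exact ⟨p, fun w hw => of_mem_support hp hw⟩

theorem class_conn (h : G.ConnIn A x y) (h' : G.ConnIn A x z) :
    G.ConnIn {z | G.ConnIn A x z} y z :=
  h.to_class.symm.trans h'.to_class

theorem exists_isPath (h : G.ConnIn A x y) : ∃ p : G.Walk x y, p.IsPath ∧ ∀ z ∈ p.support, z ∈ A := by
  classical
  obtain ⟨p, hp⟩ := h
  exact ⟨p.bypass, p.bypass_isPath, fun z hz => hp _ (p.support_bypass_subset_support hz)⟩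

theorem reachable_induce (h : G.ConnIn A x y) :
    (G.induce A).Reachable ⟨x, h.left_mem⟩ ⟨y, h.right_mem⟩ := by
  obtain ⟨p, hp⟩ := h
  exact ⟨p.induce A hp⟩

theorem map {W : Type*} {H : SimpleGraph W} {D : Set W} {a b : W} (h : H.ConnIn D a b) (f : H →g G)
    (hf : ∀ w ∈ D, f w ∈ A) : G.ConnIn A (f a) (f b) := by
  obtain ⟨p, hp⟩ := h
  refine ⟨p.map f, fun z hz => ?_⟩
  rw [Walk.support_map, List.mem_map] at hz
  obtain ⟨w, hw, rfl⟩ := hz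
  exact hf w (hp w hw)

theorem of_reachable_induce {x y : A} (h : (G.induce A).Reachable x y) : G.ConnIn A x y := by
  obtain ⟨p⟩ := h
  exact ConnIn.map (D := Set.univ) ⟨p, by simp⟩ (Embedding.induce A).toHom fun w _ => w.2

theorem induce_connected (hne : A.Nonempty) (h : ∀ x ∈ A, ∀ y ∈ A, G.ConnIn A x y) :
    (G.induce A).Connected := by
  have : Nonempty A := hne.to_subtype
  exact ⟨fun x y => (h x x.2 y y.2).reachable_induce⟩

theorem class_induce_connected (hx : x ∈ A) : (G.induce {z | G.ConnIn A x z}).Connected :=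
  induce_connected ⟨x, refl hx⟩ fun _ h _ h' => class_conn h h'

/-- Keep the parts of a walk before its first and after its last use of the edge. If these uses have
opposite directions, the two parts meet at an end of the edge and the edge is not needed. -/
theorem deleteEdge_cases {u v : V} (h : G.ConnIn A x y) :
    (G.deleteEdges {s(u, v)}).ConnIn A x y ∨
    ((G.deleteEdges {s(u, v)}).ConnIn A x u ∧ (G.deleteEdges {s(u, v)}).ConnIn A v y) ∨
    ((G.deleteEdges {s(u, v)}).ConnIn A x v ∧ (G.deleteEdges {s(u, v)}).ConnIn A u y) := by
  obtain ⟨p, hp⟩ := h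
  induction p with
  | nil => exact .inl (refl (hp _ (by simp)))
  | @cons a c b hadj p ih =>
    have ha : a ∈ A := hp _ (by simp)
    have hc : c ∈ A := hp _ (by simp)
    have ih := ih fun w hw => hp _ (by simp [hw])
    by_cases he : s(a, c) = s(u, v)
    · rcases Sym2.eq_iff.1 he with ⟨rfl, rfl⟩ | ⟨rfl, rfl⟩
      · rcases ih with h | h | h
        · exact .inr (.inl ⟨refl ha, h⟩)
        · exact .inr (.inl ⟨refl ha, h.2⟩)
        · exact .inl h.2
      · rcases ih with h | h | h
        · exact .inr (.inr ⟨refl ha, h⟩)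
        · exact .inl h.2
        · exact .inr (.inr ⟨refl ha, h.2⟩)
    · have h1 : (G.deleteEdges {s(u, v)}).ConnIn A a c :=
        of_adj ha hc (by simpa [deleteEdges_adj] using ⟨hadj, by simpa using he⟩)
      rcases ih with h | h | h
      · exact .inl (h1.trans h)
      · exact .inr (.inl ⟨h1.trans h.1, h.2⟩)
      · exact .inr (.inr ⟨h1.trans h.1, h.2⟩)

end ConnIn

/-! ### Menger's theorem for two paths and separating vertices -/

/-- Menger's theorem for two paths: if no vertex separates `A` from `B` then there are two
disjoint walks from `A` to `B`. -/
theorem exists_two_disjoint_walks {V : Type*} [Finite V] [Nonempty V] (E : SimpleGraph V)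
    (A B : Set V) (h : ∀ x, ∃ a ∈ A, ∃ b ∈ B, E.ConnIn {x}ᶜ a b) :
    ∃ a ∈ A, ∃ b ∈ B, ∃ a' ∈ A, ∃ b' ∈ B, ∃ p : E.Walk a b, ∃ q : E.Walk a' b',
      ∀ z ∈ p.support, z ∉ q.support := by
  classical
  induction hn : E.edgeSet.ncard using Nat.strong_induction_on generalizing E A B with
  | _ n ih =>
  by_cases hE : ∃ x y, E.Adj x y
  swap
  · push Not at hE
    have key : ∀ x, ∃ a ∈ A, a ∈ B ∧ a ≠ x := by
      intro x
      obtain ⟨a, ha, b, hb, p, hp⟩ := h x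
      cases p with
      | nil => exact ⟨a, ha, hb, fun h => hp a (by simp) h⟩
      | cons hadj _ => exact absurd hadj (hE _ _)
    obtain ⟨a, ha, ha', -⟩ := key (Classical.arbitrary V)
    obtain ⟨b, hb, hb', hab⟩ := key a
    exact ⟨a, ha, a, ha', b, hb, b, hb', .nil, .nil, by simpa using hab.symm⟩
  obtain ⟨x₀, y₀, hxy₀⟩ := hE
  have hlt : ∀ x y, E.Adj x y → (E.deleteEdges {s(x, y)}).edgeSet.ncard < n := by
    intro x y hxy
    rw [← hn, edgeSet_deleteEdges]
    exact Set.ncard_sdiff_singleton_lt_of_mem hxy (Set.toFinite _)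
  have hle : ∀ x y, E.deleteEdges {s(x, y)} ≤ E := fun x y => deleteEdges_le _
  by_cases hsep : ∀ z, ∃ a ∈ A, ∃ b ∈ B, (E.deleteEdges {s(x₀, y₀)}).ConnIn {z}ᶜ a b
  · obtain ⟨a, ha, b, hb, a', ha', b', hb', p, q, hpq⟩ := ih _ (hlt _ _ hxy₀) _ A B hsep rfl
    exact ⟨a, ha, b, hb, a', ha', b', hb', p.mapLe (hle _ _), q.mapLe (hle _ _), by simpa using hpq⟩
  push Not at hsep
  obtain ⟨s, hs₀⟩ := hsep
  -- The deleted edge is oriented so that `x` lies on the `A` side and `y` on the `B` side of the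
  -- separating vertex `s`. Then no single vertex separates `A` from {s, x} or {s, y} from `B`
  -- without the edge; the two pairs of walks found there are glued at `s` and along the edge.
  obtain ⟨x, y, hxy, hs, a₀, ha₀, b₀, hb₀, hax, hyb⟩ : ∃ x y, E.Adj x y ∧
      (∀ a ∈ A, ∀ b ∈ B, ¬ (E.deleteEdges {s(x, y)}).ConnIn {s}ᶜ a b) ∧
      ∃ a ∈ A, ∃ b ∈ B, (E.deleteEdges {s(x, y)}).ConnIn {s}ᶜ a x ∧
        (E.deleteEdges {s(x, y)}).ConnIn {s}ᶜ y b := by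
    obtain ⟨a, ha, b, hb, hab⟩ := h s
    rcases hab.deleteEdge_cases (u := x₀) (v := y₀) with h | h | h
    · exact absurd h (hs₀ a ha b hb)
    · exact ⟨x₀, y₀, hxy₀, hs₀, a, ha, b, hb, h⟩
    · refine ⟨y₀, x₀, hxy₀.symm, ?_, a, ha, b, hb, ?_⟩ <;> rw [Sym2.eq_swap (a := y₀)]
      exacts [hs₀, h]
  set E' := E.deleteEdges {s(x, y)}
  have hsdiff : ∀ (C : Set V), C \ {s} ⊆ {s}ᶜ := fun C z hz => hz.2
  have hx : x ≠ s := hax.right_mem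
  have hy : y ≠ s := hyb.left_mem
  have h1 : ∀ z, ∃ a ∈ A, ∃ t ∈ ({s, x} : Set V), E'.ConnIn {z}ᶜ a t := by
    intro z
    obtain ⟨a, ha, b, hb, hab⟩ := h z
    rcases hab.deleteEdge_cases (u := x) (v := y) with h | h | h
    · rcases h.avoid_or s with h' | h'
      · exact absurd (h'.mono (hsdiff _)) (hs a ha b hb)
      · exact ⟨a, ha, s, by simp, h'.1⟩
    · exact ⟨a, ha, x, by simp, h.1⟩
    · rcases h.1.avoid_or s with h' | h'
      · exact absurd ((h'.mono (hsdiff _)).trans hyb) (hs a ha b₀ hb₀)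
      · exact ⟨a, ha, s, by simp, h'.1⟩
  have h2 : ∀ z, ∃ t ∈ ({s, y} : Set V), ∃ b ∈ B, E'.ConnIn {z}ᶜ t b := by
    intro z
    obtain ⟨a, ha, b, hb, hab⟩ := h z
    rcases hab.deleteEdge_cases (u := x) (v := y) with h | h | h
    · rcases h.avoid_or s with h' | h'
      · exact absurd (h'.mono (hsdiff _)) (hs a ha b hb)
      · exact ⟨s, by simp, b, hb, h'.2⟩
    · exact ⟨y, by simp, b, hb, h.2⟩
    · rcases h.2.avoid_or s with h' | h'
      · exact absurd (hax.trans (h'.mono (hsdiff _))) (hs a₀ ha₀ b hb)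
      · exact ⟨s, by simp, b, hb, h'.2⟩
  obtain ⟨a, ha, a', ha', P, P', hPP'⟩ : ∃ a ∈ A, ∃ a' ∈ A, ∃ p : E'.Walk a s,
      ∃ q : E'.Walk a' x, ∀ z ∈ p.support, z ∉ q.support := by
    obtain ⟨a, ha, t, ht, a', ha', t', ht', p, q, hpq⟩ := ih _ (hlt _ _ hxy) _ A _ h1 rfl
    rcases ht with rfl | rfl <;> rcases ht' with rfl | rfl
    · exact absurd q.end_mem_support (hpq _ p.end_mem_support)
    · exact ⟨a, ha, a', ha', p, q, hpq⟩
    · exact ⟨a', ha', a, ha, q, p, fun z hz hz' => hpq z hz' hz⟩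
    · exact absurd q.end_mem_support (hpq _ p.end_mem_support)
  obtain ⟨b, hb, b', hb', Q, Q', hQQ'⟩ : ∃ b ∈ B, ∃ b' ∈ B, ∃ p : E'.Walk s b,
      ∃ q : E'.Walk y b', ∀ z ∈ p.support, z ∉ q.support := by
    obtain ⟨t, ht, b, hb, t', ht', b', hb', p, q, hpq⟩ := ih _ (hlt _ _ hxy) _ _ B h2 rfl
    rcases ht with rfl | rfl <;> rcases ht' with rfl | rfl
    · exact absurd q.start_mem_support (hpq _ p.start_mem_support)
    · exact ⟨b, hb, b', hb', p, q, hpq⟩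
    · exact ⟨b', hb', b, hb, q, p, fun z hz hz' => hpq z hz' hz⟩
    · exact absurd q.start_mem_support (hpq _ p.start_mem_support)
  have hsP' : s ∉ P'.support := hPP' s P.end_mem_support
  have hsQ' : s ∉ Q'.support := hQQ' s Q.start_mem_support
  -- Passing to a path makes `s` occur only at its end, so all other vertices stay on the `A` side
  -- of `s`; walks from opposite sides can then meet only in `s`.
  have hP : ∀ w ∈ P.bypass.support, w ≠ s → E'.ConnIn {s}ᶜ a w := fun w hw hne =>
    ⟨P.bypass.takeUntil w hw, fun z hz hzs =>
      Walk.endpoint_notMem_support_takeUntil P.bypass_isPath hw hne.symm (hzs ▸ hz)⟩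
  have hQ : ∀ w ∈ Q.bypass.support, w ≠ s → E'.ConnIn {s}ᶜ b w := by
    intro w hw hne
    have hw' : w ∈ Q.bypass.reverse.support := by simpa using hw
    exact ⟨Q.bypass.reverse.takeUntil w hw', fun z hz hzs =>
      Walk.endpoint_notMem_support_takeUntil Q.bypass_isPath.reverse hw' hne.symm (hzs ▸ hz)⟩
  have hP' : ∀ w ∈ P'.support, E'.ConnIn {s}ᶜ a' w := fun w hw =>
    ConnIn.of_mem_support (p := P') (fun z hz hzs => hsP' (hzs ▸ hz)) hw
  have hQ' : ∀ w ∈ Q'.support, E'.ConnIn {s}ᶜ b' w := fun w hw =>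
    ConnIn.of_mem_support (p := Q'.reverse)
      (fun z hz hzs => hsQ' (by have h0 : z = s := hzs; subst h0; simpa using hz)) (by simpa using hw)
  refine ⟨a, ha, b, hb, a', ha', b', hb',
    (P.bypass.append Q.bypass).mapLe (hle x y),
    (P'.mapLe (hle x y)).append (.cons hxy (Q'.mapLe (hle x y))), fun z hz hz' => ?_⟩
  rw [Walk.support_mapLe_eq_support, Walk.mem_support_append_iff] at hz
  simp only [Walk.mem_support_append_iff, Walk.support_cons, List.mem_cons,
    Walk.support_mapLe_eq_support] at hz'
  have hz' : z ∈ P'.support ∨ z ∈ Q'.support := by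
    rcases hz' with h | rfl | h
    exacts [.inl h, .inl P'.end_mem_support, .inr h]
  have hzs : z ≠ s := by rintro rfl; exact hz'.elim hsP' hsQ'
  rcases hz with h | h <;> rcases hz' with h' | h'
  · exact hPP' z (P.support_bypass_subset_support h) h'
  · exact hs a ha b' hb' ((hP z h hzs).trans (hQ' z h').symm)
  · exact hs a' ha' b hb ((hP' z h').trans (hQ z h hzs).symm)
  · exact hQQ' z (Q.support_bypass_subset_support h) h'

/-- In a `K₄`-minor-free graph, a connected set `X` that is attached to two vertices `u`, `v`
joined outside `X` has a vertex separating the neighbours of `u` from those of `v`. -/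
theorem K4MinorFree.exists_separator {V : Type*} [Finite V] {G : SimpleGraph V}
    (hG : G.K4MinorFree) {u v : V} {X : Set V} (hX : ∀ x ∈ X, ∀ y ∈ X, G.ConnIn X x y)
    (huX : u ∉ X) (hvX : v ∉ X) (huv : u ≠ v) (hne : X.Nonempty) (hout : G.ConnIn Xᶜ u v) :
    ∃ x ∈ X, ∀ a ∈ X, ∀ b ∈ X, G.Adj u a → G.Adj v b → ¬ G.ConnIn (X \ {x}) a b := by
  classical
  by_contra hcon
  push Not at hcon
  have : Nonempty X := hne.to_subtype
  obtain ⟨a, ha, b, hb, a', ha', b', hb', p, q, hpq⟩ :=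
    exists_two_disjoint_walks (G.induce X) {a | G.Adj u a} {b | G.Adj v b} (by
      intro x
      obtain ⟨a, ha, b, hb, hua, hvb, p, hp⟩ := hcon x x.2
      refine ⟨⟨a, ha⟩, hua, ⟨b, hb⟩, hvb, p.induce X fun z hz => (hp z hz).1, fun z hz hzx => ?_⟩
      rw [Walk.support_induce] at hz
      obtain rfl : z = x := hzx
      simp only [List.mem_attachWith] at hz
      exact (hp _ hz).2 rfl)
  set Q : Set V := {z | ∃ w ∈ q.support, (w : V) = z}
  have hQX : Q ⊆ X := by rintro _ ⟨w, -, rfl⟩; exact w.2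
  have hqc : ∀ w ∈ q.support, G.ConnIn Q a' w := by
    intro w hw
    exact (ConnIn.of_mem_support (p := q) (A := {w | w ∈ q.support}) (fun z hz => hz) hw).map
      (Embedding.induce X).toHom fun w hw => ⟨w, hw, rfl⟩
  have hpc : ∀ w ∈ p.support, G.ConnIn (X \ Q) a w := by
    intro w hw
    refine (ConnIn.of_mem_support (p := p) (A := {w | w ∈ p.support}) (fun z hz => hz) hw).map
      (Embedding.induce X).toHom fun w hw => ⟨w.2, ?_⟩
    rintro ⟨w', hw', h⟩
    have : w' = w := Subtype.ext h
    exact hpq w hw (this ▸ hw')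
  -- The K₄ minor has branch sets `P`, `Q`, `R` and {v}. Enlarging one of the two disjoint walks to
  -- its component of `X \ Q` makes `P` adjacent to `Q`, as `X` is connected; `R` is the side of `u`
  -- outside `X`, and the outer walk makes it adjacent to `v`.
  set P : Set V := {z | G.ConnIn (X \ Q) a z}
  set R : Set V := {z | G.ConnIn (Xᶜ \ {v}) u z}
  have haP : (a : V) ∈ P := hpc a p.start_mem_support
  have hbP : (b : V) ∈ P := hpc b p.end_mem_support
  have haQ : (a' : V) ∈ Q := ⟨a', q.start_mem_support, rfl⟩
  have hbQ : (b' : V) ∈ Q := ⟨b', q.end_mem_support, rfl⟩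
  have huR : u ∈ R := ConnIn.refl ⟨huX, huv⟩
  have hPQ : ∃ c ∈ P, ∃ d ∈ Q, G.Adj c d := by
    by_contra hno
    push Not at hno
    have : (a' : V) ∈ P := (hX a a.2 a' a'.2).closed haP fun c hc d hd hcd =>
      hc.trans (.of_adj hc.right_mem ⟨hd, fun hdQ => hno c hc d hdQ hcd⟩ hcd)
    exact this.right_mem.2 haQ
  have hRv : ∃ c ∈ R, G.Adj c v := by
    by_contra hno
    push Not at hno
    have : v ∈ R := hout.closed huR fun c hc d hd hcd =>
      hc.trans (.of_adj hc.right_mem ⟨hd, fun hdv => hno c hc (by rwa [← hdv])⟩ hcd)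
    exact this.right_mem.2 rfl
  obtain ⟨c, hc, d, hd, hcd⟩ := hPQ
  obtain ⟨e, he, hev⟩ := hRv
  have dPQ : Disjoint P Q := Set.disjoint_left.2 fun z hz hz' => hz.right_mem.2 hz'
  have dPR : Disjoint P R := Set.disjoint_left.2 fun z hz hz' => hz'.right_mem.1 hz.right_mem.1
  have dPv : Disjoint P {v} := Set.disjoint_singleton_right.2 fun h => hvX h.right_mem.1
  have dQR : Disjoint Q R := Set.disjoint_left.2 fun z hz hz' => hz'.right_mem.1 (hQX hz)
  have dQv : Disjoint Q {v} := Set.disjoint_singleton_right.2 fun h => hvX (hQX h)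
  have dRv : Disjoint R {v} := Set.disjoint_singleton_right.2 fun h => h.right_mem.2 rfl
  refine hG ⟨![P, Q, R, {v}], ?_, ?_, ?_⟩
  · intro i
    fin_cases i
    · exact ConnIn.class_induce_connected haP.left_mem
    · refine ConnIn.induce_connected ⟨_, haQ⟩ ?_
      rintro _ ⟨w, hw, rfl⟩ _ ⟨w', hw', rfl⟩
      exact (hqc w hw).symm.trans (hqc w' hw')
    · exact ConnIn.class_induce_connected huR.left_mem
    · exact ConnIn.induce_connected (A := {v}) ⟨v, rfl⟩ (by rintro _ rfl _ rfl; exact .refl rfl)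
  · intro i j hij
    fin_cases i <;> fin_cases j <;> first | exact absurd rfl hij | skip
    exacts [dPQ, dPR, dPv, dPQ.symm, dQR, dQv, dPR.symm, dQR.symm, dRv, dPv.symm, dQv.symm, dRv.symm]
  · intro i j hij
    replace hij : i ≠ j := hij
    fin_cases i <;> fin_cases j <;> first | exact absurd rfl hij | skip
    exacts [⟨c, hc, d, hd, hcd⟩, ⟨a, haP, u, huR, ha.symm⟩, ⟨b, hbP, v, rfl, hb.symm⟩,
      ⟨d, hd, c, hc, hcd.symm⟩, ⟨a', haQ, u, huR, ha'.symm⟩, ⟨b', hbQ, v, rfl, hb'.symm⟩,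
      ⟨u, huR, a, haP, ha⟩, ⟨u, huR, a', haQ, ha'⟩, ⟨e, he, v, rfl, hev⟩,
      ⟨v, rfl, b, hbP, hb⟩, ⟨v, rfl, b', hbQ, hb'⟩, ⟨v, rfl, e, he, hev.symm⟩]

/-! ### Joining and covering within degree budgets -/

section Budgets

variable {V : Type*}

theorem deg_mono [Finite V] {T T' : SimpleGraph V} (h : T ≤ T') (y : V) : T.deg y ≤ T'.deg y :=
  Set.ncard_le_ncard (fun _ hz => h hz) (Set.toFinite _)

theorem deg_sup_le [Finite V] (T T' : SimpleGraph V) (y : V) :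
    (T ⊔ T').deg y ≤ T.deg y + T'.deg y := by
  rw [deg, neighborSet_sup]
  exact Set.ncard_union_le _ _

theorem not_adj_of_deg_eq_zero [Finite V] {T : SimpleGraph V} {y z : V} (h : T.deg y = 0) :
    ¬ T.Adj y z := by
  rw [deg, Set.ncard_eq_zero] at h
  intro hyz
  exact (h ▸ (show z ∈ T.neighborSet y from hyz) : z ∈ (∅ : Set V))

/-- There is a subgraph of `G` with degrees at most `d` that joins `u` to `v` and to all of `X`. -/
def Joins (G : SimpleGraph V) (u v : V) (X : Set V) (d : V → ℕ) : Prop :=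
  ∃ T ≤ G, (∀ y ∈ X, T.Reachable u y) ∧ T.Reachable u v ∧ ∀ y, T.deg y ≤ d y

/-- There is a subgraph of `G` with degrees at most `d` that joins every vertex of `X` to `u` or
to `v`. -/
def Covers (G : SimpleGraph V) (u v : V) (X : Set V) (d : V → ℕ) : Prop :=
  ∃ T ≤ G, (∀ y ∈ X, T.Reachable u y ∨ T.Reachable v y) ∧ ∀ y, T.deg y ≤ d y

variable {G H : SimpleGraph V} {u v x : V} {X Y : Set V} {d e : V → ℕ}

theorem Joins.mono (h : G.Joins u v X d) (hde : ∀ y, d y ≤ e y) : G.Joins u v X e := by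
  obtain ⟨T, h1, h2, h3, h4⟩ := h
  exact ⟨T, h1, h2, h3, fun y => (h4 y).trans (hde y)⟩

theorem Joins.mono_graph (h : G.Joins u v X d) (hGH : G ≤ H) : H.Joins u v X d := by
  obtain ⟨T, h1, h2⟩ := h
  exact ⟨T, h1.trans hGH, h2⟩

theorem Covers.mono (h : G.Covers u v X d) (hde : ∀ y, d y ≤ e y) : G.Covers u v X e := by
  obtain ⟨T, h1, h2, h3⟩ := h
  exact ⟨T, h1, h2, fun y => (h3 y).trans (hde y)⟩

theorem Covers.symm (h : G.Covers u v X d) : G.Covers v u X d := by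
  obtain ⟨T, h1, h2, h3⟩ := h
  exact ⟨T, h1, fun y hy => (h2 y hy).symm, h3⟩

theorem Covers.empty : G.Covers u v ∅ d :=
  ⟨⊥, bot_le, by simp, fun y => by simp [deg]⟩

theorem Joins.of_adj (h : G.Adj u v) (hu : 1 ≤ d u) (hv : 1 ≤ d v) : G.Joins u v ∅ d := by
  classical
  refine ⟨edge u v, (edge_le_iff _).2 (.inr h), by simp, Adj.reachable ?_, fun y => ?_⟩
  · rw [edge_adj]
    exact ⟨.inl ⟨rfl, rfl⟩, h.ne⟩
  · have hN : (edge u v).neighborSet y ⊆ if y = u then {v} else if y = v then {u} else ∅ := by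
      intro z hz
      rw [mem_neighborSet, edge_adj] at hz
      split_ifs <;> aesop
    refine (Set.ncard_le_ncard hN (by split_ifs <;> simp)).trans ?_
    split_ifs with h1 h2
    · subst h1; simpa using hu
    · subst h2; simpa using hv
    · simp

/-- A vertex with budget 0 is isolated in the joining subgraph, so no edge at it is used. -/
theorem Joins.deleteEdge [Finite V] (h : G.Joins u v X d) {a b : V} (ha : d a = 0) :
    (G.deleteEdges {s(a, b)}).Joins u v X d := by
  obtain ⟨T, h1, h2, h3, h4⟩ := h
  refine ⟨T, fun y z hyz => ?_, h2, h3, h4⟩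
  rw [deleteEdges_adj]
  refine ⟨h1 hyz, fun he => ?_⟩
  have ha : T.deg a = 0 := Nat.le_zero.1 (ha ▸ h4 a)
  rcases Sym2.eq_iff.1 (Set.mem_singleton_iff.1 he) with ⟨rfl, rfl⟩ | ⟨rfl, rfl⟩
  · exact not_adj_of_deg_eq_zero ha hyz
  · exact not_adj_of_deg_eq_zero ha hyz.symm

variable [Finite V]

theorem Covers.parallel (h : G.Covers u v X d) (h' : G.Covers u v Y e) :
    G.Covers u v (X ∪ Y) (fun y => d y + e y) := by
  obtain ⟨T, h1, h2, h3⟩ := h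
  obtain ⟨T', h1', h2', h3'⟩ := h'
  refine ⟨T ⊔ T', sup_le h1 h1', ?_, fun y =>
    (deg_sup_le _ _ _).trans (add_le_add (h3 y) (h3' y))⟩
  rintro y (hy | hy)
  · exact (h2 y hy).imp (·.mono le_sup_left) (·.mono le_sup_left)
  · exact (h2' y hy).imp (·.mono le_sup_right) (·.mono le_sup_right)

/-- One part that joins `u` to `v` suffices: the other only has to attach each of its vertices to
either end. -/
theorem Joins.parallel (h : G.Joins u v X d) (h' : G.Covers u v Y e) :
    G.Joins u v (X ∪ Y) (fun y => d y + e y) := by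
  obtain ⟨T, h1, h2, h3, h4⟩ := h
  obtain ⟨T', h1', h2', h3'⟩ := h'
  have huv : (T ⊔ T').Reachable u v := h3.mono le_sup_left
  refine ⟨T ⊔ T', sup_le h1 h1', ?_, huv, fun y =>
    (deg_sup_le _ _ _).trans (add_le_add (h4 y) (h3' y))⟩
  rintro y (hy | hy)
  · exact (h2 y hy).mono le_sup_left
  · exact (h2' y hy).elim (·.mono le_sup_right) (fun h => huv.trans (h.mono le_sup_right))

theorem Joins.series (h : G.Joins u x X d) (h' : G.Joins x v Y e) :
    G.Joins u v (X ∪ insert x Y) (fun y => d y + e y) := by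
  obtain ⟨T, h1, h2, h3, h4⟩ := h
  obtain ⟨T', h1', h2', h3', h4'⟩ := h'
  have hux : (T ⊔ T').Reachable u x := h3.mono le_sup_left
  refine ⟨T ⊔ T', sup_le h1 h1', ?_, hux.trans (h3'.mono le_sup_right), fun y =>
    (deg_sup_le _ _ _).trans (add_le_add (h4 y) (h4' y))⟩
  rintro y (hy | rfl | hy)
  · exact (h2 y hy).mono le_sup_left
  · exact hux
  · exact hux.trans ((h2' y hy).mono le_sup_right)

theorem Covers.series (h : G.Covers u x X d) (h' : G.Joins x v Y e) :
    G.Covers u v (X ∪ insert x Y) (fun y => d y + e y) := by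
  obtain ⟨T, h1, h2, h3⟩ := h
  obtain ⟨T', h1', h2', h3', h4'⟩ := h'
  have hvx : (T ⊔ T').Reachable v x := (h3'.mono le_sup_right).symm
  refine ⟨T ⊔ T', sup_le h1 h1', ?_, fun y =>
    (deg_sup_le _ _ _).trans (add_le_add (h3 y) (h4' y))⟩
  rintro y (hy | rfl | hy)
  · exact (h2 y hy).imp (·.mono le_sup_left) (fun h => hvx.trans (h.mono le_sup_left))
  · exact .inr hvx
  · exact .inr (hvx.trans ((h2' y hy).mono le_sup_right))

end Budgets

/-! ### Bookkeeping of allowances and charges -/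

section Allowances

variable {V : Type*}

open Classical in
/-- The degree allowance `2` on `X`, plus `a` at `u` and `b` at `v`. -/
noncomputable def allowance (u v : V) (X : Set V) (a b : ℕ) (y : V) : ℕ :=
  (if y ∈ X then 2 else 0) + (if y = u then a else 0) + (if y = v then b else 0)

theorem allowance_swap (u v : V) (X : Set V) (a b : ℕ) (y : V) :
    allowance v u X b a y = allowance u v X a b y := by
  simp only [allowance]
  omega

theorem allowance_union {X Y : Set V} (h : Disjoint X Y) (u v : V) (a b a' b' : ℕ) (y : V) :
    allowance u v X a b y + allowance u v Y a' b' y =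
      allowance u v (X ∪ Y) (a + a') (b + b') y := by
  have := fun h1 : y ∈ X => Set.disjoint_left.1 h h1
  by_cases hX : y ∈ X <;> by_cases hY : y ∈ Y <;> simp_all [allowance] <;> split_ifs <;> omega

/-- The units that `x` receives from the two sides add up to the 2 allowed at an interior vertex. -/
theorem allowance_series {X Y : Set V} {u v x : V} (h : Disjoint X Y) (hX : x ∉ X) (hY : x ∉ Y)
    (a b : ℕ) (y : V) :
    allowance u x X a 1 y + allowance x v Y 1 b y = allowance u v (X ∪ insert x Y) a b y := by
  have := fun h1 : y ∈ X => Set.disjoint_left.1 h h1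
  by_cases hx : y = x
  · subst hx
    simp only [allowance, hX, hY, Set.mem_union, Set.mem_insert_iff, true_or, or_true, if_true,
      if_false]
    omega
  · by_cases hX : y ∈ X <;> by_cases hY : y ∈ Y <;> simp_all [allowance]
    omega

variable [Fintype V]

open Classical in
/-- The total weight at `y` of the sets with property `P`. -/
noncomputable def weight (Ω : Finset V → V → ℕ) (P : Finset V → Prop) (y : V) : ℕ :=
  ∑ F with P F, Ω F y

theorem weight_add_le (Ω : Finset V → V → ℕ) {P Q R : Finset V → Prop} (hPQ : ∀ F, P F → ¬ Q F)
    (hP : ∀ F, P F → R F) (hQ : ∀ F, Q F → R F) (y : V) :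
    weight Ω P y + weight Ω Q y ≤ weight Ω R y := by
  classical
  unfold weight
  rw [← Finset.sum_union (Finset.disjoint_filter.2 fun F _ => hPQ F)]
  refine Finset.sum_le_sum_of_subset fun F hF => ?_
  simp only [Finset.mem_union, Finset.mem_filter, Finset.mem_univ, true_and] at hF ⊢
  exact hF.elim (hP F) (hQ F)

/-- The weight at `y` of the pairs in `X ∪ {u, v}`. -/
noncomputable def regionWeight (Ω : Finset V → V → ℕ) (u v : V) (X : Set V) (y : V) : ℕ :=
  weight Ω (fun F => F.card = 2 ∧ (F : Set V) ⊆ X ∪ {u, v}) y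

variable {Ω : Finset V → V → ℕ} {u v x : V} {X Y : Set V}

theorem regionWeight_eq_zero (hΩ : ∀ F y, y ∉ F → Ω F y = 0) {y : V} (hy : y ∉ X ∪ {u, v}) :
    regionWeight Ω u v X y = 0 := by
  refine Finset.sum_eq_zero fun F hF => hΩ F y fun hyF => hy ?_
  simp only [Finset.mem_filter] at hF
  exact hF.2.2 (by exact_mod_cast hyF)

variable [DecidableEq V]

/-- The weight at `y` of the pairs in `X ∪ {u, v}` other than `{u, v}`. -/
noncomputable def pieceWeight (Ω : Finset V → V → ℕ) (u v : V) (X : Set V) (y : V) : ℕ :=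
  weight Ω (fun F => (F.card = 2 ∧ (F : Set V) ⊆ X ∪ {u, v}) ∧ F ≠ {u, v}) y

theorem pieceWeight_swap (Ω : Finset V → V → ℕ) (u v : V) (X : Set V) :
    pieceWeight Ω v u X = pieceWeight Ω u v X := by
  unfold pieceWeight
  rw [Finset.pair_comm, Set.pair_comm]

theorem pieceWeight_add_le_regionWeight (huv : u ≠ v) (y : V) :
    Ω {u, v} y + pieceWeight Ω u v X y ≤ regionWeight Ω u v X y := by
  have h : weight Ω (fun F => F = {u, v}) y = Ω {u, v} y := by
    simp [weight, Finset.filter_eq']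
  rw [← h]
  refine weight_add_le Ω ?_ ?_ ?_ y
  · rintro F rfl h
    exact h.2 rfl
  · rintro F rfl
    refine ⟨Finset.card_pair huv, ?_⟩
    intro z hz
    right
    simpa using hz
  · exact fun F h => h.1

/-- A pair available to both sides could only be {u, v}, which is excluded; so no charge is spent
twice. -/
theorem pieceWeight_union_le (h : Disjoint X Y) (y : V) :
    pieceWeight Ω u v X y + pieceWeight Ω u v Y y ≤ pieceWeight Ω u v (X ∪ Y) y := by
  refine weight_add_le Ω ?_ ?_ ?_ y
  · rintro F ⟨⟨h1, h2⟩, h3⟩ ⟨⟨-, h4⟩, -⟩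
    refine h3 (Finset.eq_of_subset_of_card_le (fun z hz => ?_) (by rw [h1]; exact Finset.card_le_two))
    have hz' : z ∈ (F : Set V) := by exact_mod_cast hz
    rcases h2 hz' with hzX | hzX
    · rcases h4 hz' with hzY | hzY
      · exact absurd hzY (Set.disjoint_left.1 h hzX)
      · simpa using hzY
    · simpa using hzX
  · exact fun F h => ⟨⟨h.1.1, h.1.2.trans (Set.union_subset_union_left _ Set.subset_union_left)⟩, h.2⟩
  · exact fun F h => ⟨⟨h.1.1, h.1.2.trans (Set.union_subset_union_left _ Set.subset_union_right)⟩, h.2⟩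

/-- The two regions with their ends overlap only in `x`, so they share no pair, and neither contains
both `u` and `v`. Hence the charges of {u, v} remain unspent. -/
theorem regionWeight_series_le (h : Disjoint X Y) (huv : u ≠ v) (hux : u ≠ x) (hvx : v ≠ x)
    (hu : u ∉ Y) (hv : v ∉ X) (y : V) :
    regionWeight Ω u x X y + regionWeight Ω x v Y y ≤ pieceWeight Ω u v (X ∪ insert x Y) y := by
  refine weight_add_le Ω ?_ ?_ ?_ y
  · rintro F ⟨h1, h2⟩ ⟨-, h4⟩
    have : F ⊆ {x} := by
      intro z hz
      have hz' : z ∈ (F : Set V) := by exact_mod_cast hz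
      have h2 := h2 hz'
      have h4 := h4 hz'
      simp only [Set.mem_union, Set.mem_insert_iff, Set.mem_singleton_iff] at h2 h4
      rw [Finset.mem_singleton]
      have := fun h1 : z ∈ X => Set.disjoint_left.1 h h1
      rcases h2 with h2 | rfl | h2 <;> rcases h4 with h4 | h4 | rfl <;> tauto
    have := Finset.card_le_card this
    rw [h1, Finset.card_singleton] at this
    omega
  · rintro F ⟨h1, h2⟩
    refine ⟨⟨h1, fun z hz => ?_⟩, ?_⟩
    · have := h2 hz
      simp only [Set.mem_union, Set.mem_insert_iff, Set.mem_singleton_iff] at this ⊢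
      tauto
    · rintro rfl
      have := h2 (a := v) (by simp)
      simp only [Set.mem_union, Set.mem_insert_iff, Set.mem_singleton_iff] at this
      rcases this with h | h | h
      exacts [hv h, huv h.symm, hvx h]
  · rintro F ⟨h1, h2⟩
    refine ⟨⟨h1, fun z hz => ?_⟩, ?_⟩
    · have := h2 hz
      simp only [Set.mem_union, Set.mem_insert_iff, Set.mem_singleton_iff] at this ⊢
      tauto
    · rintro rfl
      have := h2 (a := u) (by simp)
      simp only [Set.mem_union, Set.mem_insert_iff, Set.mem_singleton_iff] at this
      rcases this with h | h | h
      exacts [hu h, hux h, huv h]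

/-- If each set of a finite disjoint family can be covered in either of two ways, with a spare
unit of degree at `u` or at `v`, then the units can be distributed in any proportion. -/
theorem Covers.sUnion {G : SimpleGraph V} (𝒳 : Finset (Set V)) (a b : ℕ) (hcard : 𝒳.card ≤ a + b)
    (hdisj : ∀ X ∈ 𝒳, ∀ Y ∈ 𝒳, X ≠ Y → Disjoint X Y)
    (h₁ : ∀ X ∈ 𝒳, G.Covers u v X fun y => allowance u v X 1 0 y + pieceWeight Ω u v X y)
    (h₂ : ∀ X ∈ 𝒳, G.Covers u v X fun y => allowance u v X 0 1 y + pieceWeight Ω u v X y) :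
    G.Covers u v (⋃₀ (𝒳 : Set (Set V)))
      fun y => allowance u v (⋃₀ 𝒳) a b y + pieceWeight Ω u v (⋃₀ 𝒳) y := by
  classical
  induction 𝒳 using Finset.induction generalizing a b with
  | empty => simpa using Covers.empty
  | insert X 𝒳 hX ih =>
    rw [Finset.card_insert_of_notMem hX] at hcard
    have hd : Disjoint X (⋃₀ (𝒳 : Set (Set V))) := by
      rw [Set.disjoint_sUnion_right]
      intro Y hY
      exact hdisj X (by simp) Y (Finset.mem_insert_of_mem hY) fun h => hX (h ▸ hY)
    have ih' := fun a b h => ih a b h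
      (fun X hX Y hY => hdisj X (Finset.mem_insert_of_mem hX) Y (Finset.mem_insert_of_mem hY))
      (fun X hX => h₁ X (Finset.mem_insert_of_mem hX))
      (fun X hX => h₂ X (Finset.mem_insert_of_mem hX))
    rw [Finset.coe_insert, Set.sUnion_insert]
    have hw := fun y => pieceWeight_union_le (Ω := Ω) (u := u) (v := v) hd y
    -- The unit for `X` is taken at `u` while any is left there, otherwise at `v`; `hcard` ensures
    -- that `b` is positive in the latter case.
    rcases Nat.eq_zero_or_pos a with rfl | ha
    · refine ((h₂ X (by simp)).parallel (ih' 0 (b - 1) (by omega))).mono fun y => ?_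
      have := allowance_union hd u v 0 1 0 (b - 1) y
      rw [show 1 + (b - 1) = b by omega, Nat.add_zero] at this
      have := hw y
      omega
    · refine ((h₁ X (by simp)).parallel (ih' (a - 1) b (by omega))).mono fun y => ?_
      have := allowance_union hd u v 1 0 (a - 1) b y
      rw [show 1 + (a - 1) = a by omega, Nat.zero_add] at this
      have := hw y
      omega

end Allowances

/-! ### Pieces and regions of a biconnected set -/

section Pieces

variable {V : Type*} {G : SimpleGraph V} {S X Y A : Set V} {u v x y z : V}

/-- `S` induces a connected graph without cutvertices. -/
structure IsBiconnectedSet (G : SimpleGraph V) (S : Set V) : Prop where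
  conn : ∀ x ∈ S, ∀ y ∈ S, G.ConnIn S x y
  conn_diff : ∀ v, ∀ x ∈ S, ∀ y ∈ S, x ≠ v → y ≠ v → G.ConnIn (S \ {v}) x y

/-- `X` is the vertex set of a component of `G[S] - {u, v}`. -/
structure IsPiece (G : SimpleGraph V) (S : Set V) (u v : V) (X : Set V) : Prop where
  left_mem : u ∈ S
  right_mem : v ∈ S
  ne : u ≠ v
  exists_eq : ∃ a ∈ S \ {u, v}, X = {z | G.ConnIn (S \ {u, v}) a z}

namespace IsPiece

theorem swap (h : G.IsPiece S u v X) : G.IsPiece S v u X :=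
  ⟨h.right_mem, h.left_mem, h.ne.symm, by rw [Set.pair_comm]; exact h.exists_eq⟩

theorem subset (h : G.IsPiece S u v X) : X ⊆ S \ {u, v} := by
  obtain ⟨a, ha, rfl⟩ := h.exists_eq
  exact fun z hz => hz.right_mem

theorem left_notMem (h : G.IsPiece S u v X) : u ∉ X := fun hu => (h.subset hu).2 (by simp)

theorem right_notMem (h : G.IsPiece S u v X) : v ∉ X := h.swap.left_notMem

theorem nonempty (h : G.IsPiece S u v X) : X.Nonempty := by
  obtain ⟨a, ha, rfl⟩ := h.exists_eq
  exact ⟨a, .refl ha⟩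

theorem conn (h : G.IsPiece S u v X) : ∀ x ∈ X, ∀ y ∈ X, G.ConnIn X x y := by
  obtain ⟨a, ha, rfl⟩ := h.exists_eq
  exact fun x hx y hy => ConnIn.class_conn hx hy

theorem eq_class (h : G.IsPiece S u v X) (hx : x ∈ X) : X = {z | G.ConnIn (S \ {u, v}) x z} := by
  obtain ⟨a, ha, rfl⟩ := h.exists_eq
  ext z
  exact ⟨fun hz => ConnIn.trans (ConnIn.symm hx) hz, fun hz => ConnIn.trans hx hz⟩

theorem eq_of_mem (h : G.IsPiece S u v X) (h' : G.IsPiece S u v Y) (hx : x ∈ X) (hx' : x ∈ Y) :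
    X = Y :=
  (h.eq_class hx).trans (h'.eq_class hx').symm

theorem disjoint (h : G.IsPiece S u v X) (h' : G.IsPiece S u v Y) (hne : X ≠ Y) :
    Disjoint X Y :=
  Set.disjoint_left.2 fun _ hx hx' => hne (h.eq_of_mem h' hx hx')

theorem closed (h : G.IsPiece S u v X) (hx : x ∈ X) (hy : y ∈ S) (hyu : y ≠ u) (hyv : y ≠ v)
    (hxy : G.Adj x y) : y ∈ X := by
  rw [h.eq_class hx]
  exact .of_adj (h.subset hx) ⟨hy, by simp [hyu, hyv]⟩ hxy

/-- Otherwise deleting `v` would separate the piece from `u` within `S`. -/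
theorem exists_adj_left (h : G.IsPiece S u v X) (hS : G.IsBiconnectedSet S) :
    ∃ a ∈ X, G.Adj u a := by
  by_contra hno
  push Not at hno
  obtain ⟨x, hx⟩ := h.nonempty
  have hxS := h.subset hx
  refine h.left_notMem ((hS.conn_diff v x hxS.1 u h.left_mem ?_ h.ne).closed hx ?_)
  · rintro rfl
    exact hxS.2 (by simp)
  · intro a ha b hb hab
    refine h.closed ha hb.1 ?_ hb.2 hab
    rintro rfl
    exact hno a ha hab.symm

theorem exists_adj_right (h : G.IsPiece S u v X) (hS : G.IsBiconnectedSet S) :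
    ∃ a ∈ X, G.Adj v a := h.swap.exists_adj_left hS

theorem of_mem (hu : u ∈ S) (hv : v ∈ S) (huv : u ≠ v) (hx : x ∈ S \ {u, v}) :
    G.IsPiece S u v {z | G.ConnIn (S \ {u, v}) x z} :=
  ⟨hu, hv, huv, x, hx, rfl⟩

end IsPiece

/-- `A` is a union of components of `G[S] - {u, v}`. -/
structure IsRegion (G : SimpleGraph V) (S : Set V) (u v : V) (A : Set V) : Prop where
  left_mem : u ∈ S
  right_mem : v ∈ S
  ne : u ≠ v
  subset : A ⊆ S \ {u, v}
  closed : ∀ x ∈ A, ∀ y ∈ S \ {u, v}, G.Adj x y → y ∈ A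

namespace IsRegion

theorem class_subset (h : G.IsRegion S u v A) (hx : x ∈ A) :
    {z | G.ConnIn (S \ {u, v}) x z} ⊆ A :=
  fun _ hz => ConnIn.closed hz hx h.closed

/-- In a split, this leads through one region and so avoids the pieces of the other, as the
separator lemma requires of the outer walk. -/
theorem connIn (h : G.IsRegion S u v A) (hS : G.IsBiconnectedSet S) (hA : A = ∅ → G.Adj u v) :
    G.ConnIn (A ∪ {u, v}) u v := by
  rcases A.eq_empty_or_nonempty with rfl | ⟨a, ha⟩
  · exact .of_adj (by simp) (by simp) (hA rfl)
  · have hp := IsPiece.of_mem (G := G) h.left_mem h.right_mem h.ne (h.subset ha)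
    have hsub := h.class_subset ha
    obtain ⟨b, hb, hub⟩ := hp.exists_adj_left hS
    obtain ⟨c, hc, hvc⟩ := hp.exists_adj_right hS
    exact (ConnIn.of_adj (by simp) (.inl (hsub hb)) hub).trans
      (((hp.conn b hb c hc).mono (hsub.trans Set.subset_union_left)).trans
        (.of_adj (.inl (hsub hc)) (by simp) hvc.symm))

/-- The components that make up a region. -/
theorem exists_pieces [Finite V] (h : G.IsRegion S u v A) :
    ∃ 𝒳 : Finset (Set V), (∀ X ∈ 𝒳, G.IsPiece S u v X ∧ X ⊆ A) ∧ ⋃₀ (𝒳 : Set (Set V)) = A := by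
  have hfin : ((fun a => {z | G.ConnIn (S \ {u, v}) a z}) '' A).Finite :=
    (Set.toFinite A).image _
  refine ⟨hfin.toFinset, ?_, ?_⟩
  · intro X hX
    rw [Set.Finite.mem_toFinset] at hX
    obtain ⟨a, ha, rfl⟩ := hX
    exact ⟨.of_mem h.left_mem h.right_mem h.ne (h.subset ha), h.class_subset ha⟩
  · rw [Set.Finite.coe_toFinset, Set.sUnion_image]
    refine Set.Subset.antisymm (Set.iUnion₂_subset fun a ha => h.class_subset ha) fun a ha => ?_
    exact Set.mem_iUnion₂.2 ⟨a, ha, .refl (h.subset ha)⟩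

end IsRegion

/-- A component of `G[S] - {u, v}` splits at a vertex `x` into a region between `u` and `x` and a
region between `x` and `v`. -/
theorem IsPiece.exists_split [Finite V] (h : G.IsPiece S u v X) (hS : G.IsBiconnectedSet S)
    (hG : G.K4MinorFree) (hout : G.ConnIn Xᶜ u v) :
    ∃ x A₁ A₂, X = A₁ ∪ insert x A₂ ∧ Disjoint A₁ A₂ ∧ x ∉ A₁ ∧ x ∉ A₂ ∧
      G.IsRegion S u x A₁ ∧ G.IsRegion S x v A₂ ∧
      (A₁ = ∅ → G.Adj u x) ∧ (A₂ = ∅ → G.Adj x v) := by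
  obtain ⟨x, hx, hsep⟩ := hG.exists_separator h.conn h.left_notMem h.right_notMem h.ne h.nonempty hout
  have hxS := h.subset hx
  have hxu : x ≠ u := by rintro rfl; exact h.left_notMem hx
  have hxv : x ≠ v := by rintro rfl; exact h.right_notMem hx
  -- `A₁` collects the components of `X \ {x}` containing a neighbour of `u`, and `A₂` the others.
  -- The separation keeps `v` away from `A₁`, and the choice of `A₁` keeps `u` away from `A₂`.
  set A₁ : Set V := {y | ∃ a ∈ X, G.Adj u a ∧ G.ConnIn (X \ {x}) a y}
  have hA₁X : A₁ ⊆ X \ {x} := by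
    rintro y ⟨a, -, -, h⟩
    exact h.right_mem
  have hclosed : ∀ y ∈ A₁, ∀ z ∈ X \ {x}, G.Adj y z → z ∈ A₁ := by
    rintro y ⟨a, ha, hua, hay⟩ z hz hyz
    exact ⟨a, ha, hua, hay.trans (.of_adj hay.right_mem hz hyz)⟩
  have hsep' : ∀ y ∈ A₁, ¬ G.Adj y v := by
    rintro y ⟨a, ha, hua, hay⟩ hyv
    exact hsep a ha y hay.right_mem.1 hua hyv.symm hay
  have hmem₁ : ∀ a ∈ X, a ≠ x → G.Adj u a → a ∈ A₁ :=
    fun a ha hax hua => ⟨a, ha, hua, .refl ⟨ha, hax⟩⟩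
  refine ⟨x, A₁, (X \ {x}) \ A₁, ?_, Set.disjoint_sdiff_right, fun h => (hA₁X h).2 rfl,
    fun h => h.1.2 rfl, ⟨h.left_mem, hxS.1, hxu.symm, fun y hy => ?_, ?_⟩,
    ⟨hxS.1, h.right_mem, hxv, fun y hy => ?_, ?_⟩, ?_, ?_⟩
  · ext y
    have := @hA₁X y
    by_cases hy : y = x
    · subst hy
      simp [hx]
    · by_cases hyA : y ∈ A₁
      · simp [hyA, (this hyA).1]
      · simp [hyA, hy]
  · refine ⟨(h.subset (hA₁X hy).1).1, ?_⟩
    rintro (rfl | rfl)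
    · exact h.left_notMem (hA₁X hy).1
    · exact (hA₁X hy).2 rfl
  · rintro y hy z ⟨hzS, hz⟩ hyz
    simp only [Set.mem_insert_iff, Set.mem_singleton_iff, not_or] at hz
    refine hclosed y hy z ⟨h.closed (hA₁X hy).1 hzS hz.1 ?_ hyz, hz.2⟩ hyz
    rintro rfl
    exact hsep' y hy hyz
  · refine ⟨(h.subset hy.1.1).1, ?_⟩
    rintro (rfl | rfl)
    · exact hy.1.2 rfl
    · exact h.right_notMem hy.1.1
  · rintro y ⟨hyX, hy⟩ z ⟨hzS, hz⟩ hyz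
    simp only [Set.mem_insert_iff, Set.mem_singleton_iff, not_or] at hz
    refine ⟨⟨h.closed hyX.1 hzS ?_ hz.2 hyz, hz.1⟩, fun hz' => hy (hclosed z hz' y hyX hyz.symm)⟩
    rintro rfl
    exact hy (hmem₁ y hyX.1 hyX.2 hyz.symm)
  · intro hA
    obtain ⟨a, ha, hua⟩ := h.exists_adj_left hS
    by_cases hax : a = x
    · rwa [← hax]
    · exact absurd (hmem₁ a ha hax hua) (by simp [hA])
  · intro hA
    obtain ⟨b, hb, hvb⟩ := h.exists_adj_right hS
    by_cases hbx : b = x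
    · rw [← hbx]
      exact hvb.symm
    · exfalso
      by_cases hbA : b ∈ A₁
      · exact hsep' b hbA hvb.symm
      · exact (hA ▸ (show b ∈ (X \ {x}) \ A₁ from ⟨⟨hb, hbx⟩, hbA⟩) : b ∈ (∅ : Set V))

variable [DecidableEq V] {Ω : Finset V → V → ℕ}

/-- The weights `Ω` suffice for all components of `G[S] - {u, v}` but two, for all `u`, `v`. -/
structure IsChargeOn (G : SimpleGraph V) (S : Set V) (Ω : Finset V → V → ℕ) : Prop where
  eq_zero : ∀ F y, y ∉ F → Ω F y = 0
  card_le : ∀ u v (𝒳 : Finset (Set V)), (∀ X ∈ 𝒳, G.IsPiece S u v X) →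
    𝒳.card ≤ Ω {u, v} u + Ω {u, v} v + 2

theorem IsChargeOn.allowance_eq (h : G.IsChargeOn S Ω) (huv : u ≠ v) (y : V) :
    allowance u v X (Ω {u, v} u) (Ω {u, v} v) y = allowance u v X 0 0 y + Ω {u, v} y := by
  by_cases h1 : y = u
  · subst h1
    simp [allowance, huv]
  · by_cases h2 : y = v
    · subst h2
      simp [allowance, h1]
    · simp [allowance, h1, h2, h.eq_zero {u, v} y (by simp [h1, h2])]

variable [Fintype V]

/-- A region with a further component outside it is joined, or covered with nothing but charges at
`u`, provided that its components are. -/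
theorem IsRegion.joins_and_covers (h : G.IsRegion S u v A) (hΩ : G.IsChargeOn S Ω)
    (hA : A = ∅ → G.Adj u v) {w : V} (hw : w ∈ S \ {u, v}) (hwA : w ∉ A)
    (hJ : ∀ X ⊆ A, G.IsPiece S u v X →
      G.Joins u v X fun y => allowance u v X 1 1 y + pieceWeight Ω u v X y)
    (h₁ : ∀ X ⊆ A, G.IsPiece S u v X →
      G.Covers u v X fun y => allowance u v X 1 0 y + pieceWeight Ω u v X y)
    (h₂ : ∀ X ⊆ A, G.IsPiece S u v X →
      G.Covers u v X fun y => allowance u v X 0 1 y + pieceWeight Ω u v X y) :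
    (G.Joins u v A fun y => allowance u v A 1 1 y + regionWeight Ω u v A y) ∧
      G.Covers u v A fun y => allowance u v A 0 1 y + regionWeight Ω u v A y := by
  classical
  obtain ⟨𝒳, h𝒳, rfl⟩ := h.exists_pieces
  have hp : ∀ X ∈ 𝒳, G.IsPiece S u v X := fun X hX => (h𝒳 X hX).1
  -- The piece of `w` lies outside the region, which lowers the 2 of `card_le` to 1.
  have hcard : 𝒳.card ≤ Ω {u, v} u + Ω {u, v} v + 1 := by
    have hW := IsPiece.of_mem (G := G) h.left_mem h.right_mem h.ne hw
    have hnot : {z | G.ConnIn (S \ {u, v}) w z} ∉ 𝒳 := fun hmem =>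
      hwA (Set.mem_sUnion.2 ⟨_, hmem, .refl hw⟩)
    have := hΩ.card_le u v (insert {z | G.ConnIn (S \ {u, v}) w z} 𝒳) (by
      intro X hX
      rcases Finset.mem_insert.1 hX with rfl | hX
      exacts [hW, hp X hX])
    rw [Finset.card_insert_of_notMem hnot] at this
    omega
  have hwt := fun X y => pieceWeight_add_le_regionWeight (Ω := Ω) (X := X) h.ne y
  have hcov : ∀ (𝒴 : Finset (Set V)) (a b : ℕ), 𝒴 ⊆ 𝒳 → 𝒴.card ≤ a + b →
      G.Covers u v (⋃₀ (𝒴 : Set (Set V)))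
        fun y => allowance u v (⋃₀ 𝒴) a b y + pieceWeight Ω u v (⋃₀ 𝒴) y := by
    intro 𝒴 a b h𝒴 hab
    exact Covers.sUnion 𝒴 a b hab (fun X hX Y hY => (hp X (h𝒴 hX)).disjoint (hp Y (h𝒴 hY)))
      (fun X hX => h₁ X (h𝒳 X (h𝒴 hX)).2 (hp X (h𝒴 hX)))
      (fun X hX => h₂ X (h𝒳 X (h𝒴 hX)).2 (hp X (h𝒴 hX)))
  refine ⟨?_, ?_⟩
  · rcases 𝒳.eq_empty_or_nonempty with rfl | ⟨X, hX⟩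
    · simp only [Finset.coe_empty, Set.sUnion_empty] at hA ⊢
      refine Joins.of_adj (hA trivial) ?_ ?_ <;> simp [allowance] <;> omega
    -- One piece is joined; the charges of {u, v} pay for covering all the others.
    · obtain ⟨𝒴, hX𝒴, rfl⟩ : ∃ 𝒴, X ∉ 𝒴 ∧ insert X 𝒴 = 𝒳 :=
        ⟨𝒳.erase X, Finset.notMem_erase _ _, Finset.insert_erase hX⟩
      rw [Finset.card_insert_of_notMem hX𝒴] at hcard
      have hd : Disjoint X (⋃₀ (𝒴 : Set (Set V))) := by
        rw [Set.disjoint_sUnion_right]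
        intro Y hY
        exact (hp X hX).disjoint (hp Y (Finset.mem_insert_of_mem hY)) fun h => hX𝒴 (h ▸ hY)
      have hc := hcov 𝒴 (Ω {u, v} u) (Ω {u, v} v) (Finset.subset_insert _ _) (by omega)
      have hj := (hJ X (h𝒳 X hX).2 (hp X hX)).parallel hc
      rw [Finset.coe_insert, Set.sUnion_insert]
      refine hj.mono fun y => ?_
      have e1 := hΩ.allowance_eq (X := ⋃₀ (𝒴 : Set (Set V))) h.ne y
      have e2 := allowance_union hd u v 1 1 0 0 y
      have e3 := pieceWeight_union_le (Ω := Ω) (u := u) (v := v) hd y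
      have e4 := hwt (X ∪ ⋃₀ (𝒴 : Set (Set V))) y
      simp only [Nat.add_zero] at e2
      omega
  -- Here every piece is only covered, and the extra unit at `v` pays for the one that the charges
  -- miss.
  · refine (hcov 𝒳 (Ω {u, v} u) (Ω {u, v} v + 1) subset_rfl (by omega)).mono fun y => ?_
    have e1 := hΩ.allowance_eq (X := ⋃₀ (𝒳 : Set (Set V))) h.ne y
    have e4 := hwt (⋃₀ (𝒳 : Set (Set V))) y
    have e5 : allowance u v (⋃₀ (𝒳 : Set (Set V))) (Ω {u, v} u) (Ω {u, v} v + 1) y +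
          allowance u v (⋃₀ (𝒳 : Set (Set V))) 0 0 y =
        allowance u v (⋃₀ (𝒳 : Set (Set V))) (Ω {u, v} u) (Ω {u, v} v) y +
          allowance u v (⋃₀ (𝒳 : Set (Set V))) 0 1 y := by
      simp only [allowance]
      split_ifs <;> omega
    omega

/-- A component of `G[S] - {u, v}` can be joined to `u` and `v` with one unit of degree at each of
them, and covered with one unit at `v`, apart from the charges. -/
theorem IsPiece.joins_and_covers (hS : G.IsBiconnectedSet S) (hG : G.K4MinorFree)
    (hΩ : G.IsChargeOn S Ω) (h : G.IsPiece S u v X) (hout : G.ConnIn Xᶜ u v) :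
    ((G.deleteEdges {s(u, v)}).Joins u v X
        fun y => allowance u v X 1 1 y + pieceWeight Ω u v X y) ∧
      G.Covers u v X fun y => allowance u v X 0 1 y + pieceWeight Ω u v X y := by
  induction hn : X.ncard using Nat.strong_induction_on generalizing u v X with
  | _ n ih =>
  obtain ⟨x, A₁, A₂, hX, hd, hx₁, hx₂, hr₁, hr₂, he₁, he₂⟩ := h.exists_split hS hG hout
  have hA₁X : A₁ ⊆ X := hX ▸ Set.subset_union_left
  have hA₂X : A₂ ⊆ X := hX ▸ (Set.subset_insert _ _).trans Set.subset_union_right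
  have hxX : x ∈ X := hX ▸ .inr (.inl rfl)
  have hxu := hr₁.ne
  have hxv := hr₂.ne
  have huX := h.left_notMem
  have hvX := h.right_notMem
  have hlt : ∀ Y ⊆ X, x ∉ Y → Y.ncard < n := fun Y hY hxY =>
    hn ▸ Set.ncard_lt_ncard ⟨hY, fun hXY => hxY (hXY hxX)⟩
  have huv : ∀ Y ⊆ X, G.ConnIn Yᶜ u v := fun Y hY => hout.mono (Set.compl_subset_compl.2 hY)
  have hux : ∀ Y ⊆ A₁, G.ConnIn Yᶜ u x := by
    intro Y hY
    refine (huv Y (hY.trans hA₁X)).trans ((hr₂.connIn hS he₂).mono ?_).symm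
    rintro z (hz | rfl | rfl) hzY
    exacts [Set.disjoint_left.1 hd (hY hzY) hz, hx₁ (hY hzY), hvX (hA₁X (hY hzY))]
  have hxv' : ∀ Y ⊆ A₂, G.ConnIn Yᶜ x v := by
    intro Y hY
    refine ((hr₁.connIn hS he₁).mono ?_).symm.trans (huv Y (hY.trans hA₂X))
    rintro z (hz | rfl | rfl) hzY
    exacts [Set.disjoint_left.1 hd hz (hY hzY), huX (hA₂X (hY hzY)), hx₂ (hY hzY)]
  have hpc : ∀ {a b : V} {Y : Set V}, Y.ncard < n → G.IsPiece S a b Y → G.ConnIn Yᶜ a b →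
      (G.Joins a b Y fun y => allowance a b Y 1 1 y + pieceWeight Ω a b Y y) ∧
      (G.Covers a b Y fun y => allowance a b Y 1 0 y + pieceWeight Ω a b Y y) ∧
      (G.Covers a b Y fun y => allowance a b Y 0 1 y + pieceWeight Ω a b Y y) := by
    intro a b Y hY hp hc
    -- The claim covers with a unit at the second end; applied to the swapped pair it gives the unit
    -- at the first.
    have e1 := ih _ hY hp hc rfl
    have e2 := (ih _ hY hp.swap hc.symm rfl).2.symm
    simp only [pieceWeight_swap Ω a b, allowance_swap a b] at e2
    exact ⟨e1.1.mono_graph (deleteEdges_le _), e2, e1.2⟩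
  have hp₁ := fun Y (hY : Y ⊆ A₁) (hp : G.IsPiece S u x Y) =>
    hpc (hlt Y (hY.trans hA₁X) fun h => hx₁ (hY h)) hp (hux Y hY)
  have hp₂ := fun Y (hY : Y ⊆ A₂) (hp : G.IsPiece S x v Y) =>
    hpc (hlt Y (hY.trans hA₂X) fun h => hx₂ (hY h)) hp (hxv' Y hY)
  have c₁ := hr₁.joins_and_covers hΩ he₁ (w := v) ⟨h.right_mem, by simp [h.ne.symm, hxv.symm]⟩
    (fun h => hvX (hA₁X h)) (fun Y hY hp => (hp₁ Y hY hp).1) (fun Y hY hp => (hp₁ Y hY hp).2.1)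
    (fun Y hY hp => (hp₁ Y hY hp).2.2)
  have c₂ := hr₂.joins_and_covers hΩ he₂ (w := u) ⟨h.left_mem, by simp [h.ne, hxu]⟩
    (fun h => huX (hA₂X h)) (fun Y hY hp => (hp₂ Y hY hp).1) (fun Y hY hp => (hp₂ Y hY hp).2.1)
    (fun Y hY hp => (hp₂ Y hY hp).2.2)
  have hw := fun y => regionWeight_series_le (Ω := Ω) hd h.ne hxu hxv.symm
    (fun h => huX (hA₂X h)) (fun h => hvX (hA₁X h)) y
  have hvA₁ : v ∉ A₁ := fun h => hvX (hA₁X h)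
  have huA₂ : u ∉ A₂ := fun h => huX (hA₂X h)
  -- The first region has no budget at `v` and the second none at `u`, so the edge between `u` and
  -- `v` is never used.
  have hz₁ : allowance u x A₁ 1 1 v + regionWeight Ω u x A₁ v = 0 := by
    rw [regionWeight_eq_zero hΩ.eq_zero (by simp [hvA₁, h.ne.symm, hxv.symm])]
    simp [allowance, hvA₁, h.ne.symm, hxv.symm]
  have hz₂ : allowance x v A₂ 1 1 u + regionWeight Ω x v A₂ u = 0 := by
    rw [regionWeight_eq_zero hΩ.eq_zero (by simp [huA₂, h.ne, hxu])]
    simp [allowance, huA₂, h.ne, hxu]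
  have j₁ := c₁.1.deleteEdge (b := u) hz₁
  rw [Sym2.eq_swap] at j₁
  have j₂ := c₂.1.deleteEdge (b := v) hz₂
  rw [hX]
  refine ⟨(j₁.series j₂).mono fun y => ?_, (c₁.2.series c₂.1).mono fun y => ?_⟩
  · have := hw y
    have := allowance_series (u := u) (v := v) hd hx₁ hx₂ 1 1 y
    omega
  · have := hw y
    have := allowance_series (u := u) (v := v) hd hx₁ hx₂ 0 1 y
    omega

end Pieces

/-! ### Blocks as maximal biconnected sets -/

section Blocks

variable {V : Type*} {G : SimpleGraph V} {S S' A : Set V} {a b c u v x y : V}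

theorem ConnIn.induce_preimage (h : G.ConnIn A x y) (hA : A ⊆ S) :
    (G.induce S).ConnIn (Subtype.val ⁻¹' A) ⟨x, hA h.left_mem⟩ ⟨y, hA h.right_mem⟩ := by
  obtain ⟨p, hp⟩ := h
  refine ⟨p.induce S fun z hz => hA (hp z hz), fun z hz => ?_⟩
  rw [Walk.support_induce] at hz
  simp only [List.mem_attachWith] at hz
  exact hp _ hz

/-- A path minus a vertex consists of at most two segments, each containing an end of the path. -/
theorem Walk.IsPath.connIn_avoid {p : G.Walk a b} (hp : p.IsPath) (hx : x ∈ p.support)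
    (hxv : x ≠ v) :
    G.ConnIn ({z | z ∈ p.support} \ {v}) x a ∨ G.ConnIn ({z | z ∈ p.support} \ {v}) x b := by
  classical
  by_cases h : v ∈ (p.takeUntil x hx).support
  · right
    refine ⟨p.dropUntil x hx, fun z hz => ⟨p.support_dropUntil_subset_support hx hz, ?_⟩⟩
    rintro rfl
    have hn := hp.support_nodup
    rw [← p.take_spec hx, Walk.support_append] at hn
    refine (List.nodup_append.1 hn).2.2 _ h _ ?_ rfl
    rw [← Walk.cons_tail_support] at hz
    exact (List.mem_cons.1 hz).resolve_left hxv.symm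
  · left
    refine ConnIn.symm ⟨p.takeUntil x hx, fun z hz => ⟨p.support_takeUntil_subset_support hx hz, ?_⟩⟩
    rintro rfl
    exact h hz

theorem IsBiconnectedSet.pair (h : G.Adj a b) : G.IsBiconnectedSet {a, b} := by
  have key : ∀ A : Set V, ∀ x ∈ ({a, b} : Set V), ∀ y ∈ ({a, b} : Set V), x ∈ A → y ∈ A →
      G.ConnIn A x y := by
    rintro A x (rfl | rfl) y (rfl | rfl) hx hy
    exacts [.refl hx, .of_adj hx hy h, .of_adj hx hy h.symm, .refl hx]
  exact ⟨fun x hx y hy => key _ x hx y hy hx hy,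
    fun v x hx y hy hxv hyv => key _ x hx y hy ⟨hx, hxv⟩ ⟨hy, hyv⟩⟩

theorem IsBiconnectedSet.of_hubs (h : ∃ c, ∀ x ∈ S, G.ConnIn S x c)
    (h' : ∀ v, ∃ c, ∀ x ∈ S, x ≠ v → G.ConnIn (S \ {v}) x c) : G.IsBiconnectedSet S := by
  obtain ⟨c, hc⟩ := h
  refine ⟨fun x hx y hy => (hc x hx).trans (hc y hy).symm, fun v x hx y hy hxv hyv => ?_⟩
  obtain ⟨c, hc⟩ := h' v
  exact (hc x hx hxv).trans (hc y hy hyv).symm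

/-- Adding an ear to a biconnected set. -/
theorem IsBiconnectedSet.union_path (hS : G.IsBiconnectedSet S) (ha : a ∈ S) (hb : b ∈ S)
    (hab : a ≠ b) {p : G.Walk a b} (hp : p.IsPath) :
    G.IsBiconnectedSet (S ∪ {z | z ∈ p.support}) := by
  refine .of_hubs ⟨a, ?_⟩ fun v => ?_
  · rintro x (hx | hx)
    · exact (hS.conn x hx a ha).mono Set.subset_union_left
    · exact (ConnIn.of_mem_support (fun z hz => .inr hz) hx).symm
  · obtain ⟨c, hc, hcv⟩ : ∃ c ∈ S, c ≠ v := by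
      by_cases h : a = v
      exacts [⟨b, hb, h ▸ hab.symm⟩, ⟨a, ha, h⟩]
    have hsub : S \ {v} ⊆ (S ∪ {z | z ∈ p.support}) \ {v} :=
      Set.sdiff_subset_sdiff_left Set.subset_union_left
    have hsub' : {z | z ∈ p.support} \ {v} ⊆ (S ∪ {z | z ∈ p.support}) \ {v} :=
      Set.sdiff_subset_sdiff_left Set.subset_union_right
    refine ⟨c, ?_⟩
    rintro x (hx | hx) hxv
    · exact (hS.conn_diff v x hx c hc hxv hcv).mono hsub
    · rcases hp.connIn_avoid hx hxv with h | h
      · exact (h.mono hsub').trans ((hS.conn_diff v a ha c hc h.right_mem.2 hcv).mono hsub)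
      · exact (h.mono hsub').trans ((hS.conn_diff v b hb c hc h.right_mem.2 hcv).mono hsub)

/-- Two biconnected sets sharing a vertex `c`, together with a path between them that avoids
`c`. -/
theorem IsBiconnectedSet.union_union_path (hS : G.IsBiconnectedSet S) (hS' : G.IsBiconnectedSet S')
    (hc : c ∈ S) (hc' : c ∈ S') (ha : a ∈ S) (hb : b ∈ S') {p : G.Walk a b} (hp : p.IsPath)
    (hcp : c ∉ p.support) : G.IsBiconnectedSet (S ∪ S' ∪ {z | z ∈ p.support}) := by
  have hsub : ∀ v, S \ {v} ⊆ (S ∪ S' ∪ {z | z ∈ p.support}) \ {v} := fun v =>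
    Set.sdiff_subset_sdiff_left (Set.subset_union_left.trans Set.subset_union_left)
  have hsub' : ∀ v, S' \ {v} ⊆ (S ∪ S' ∪ {z | z ∈ p.support}) \ {v} := fun v =>
    Set.sdiff_subset_sdiff_left (Set.subset_union_right.trans Set.subset_union_left)
  have hsubp : ∀ v, {z | z ∈ p.support} \ {v} ⊆ (S ∪ S' ∪ {z | z ∈ p.support}) \ {v} := fun v =>
    Set.sdiff_subset_sdiff_left Set.subset_union_right
  have hne : ∀ z ∈ p.support, z ≠ c := fun z hz h => hcp (h ▸ hz)
  have hac := hne a p.start_mem_support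
  have hbc := hne b p.end_mem_support
  have hpa : ∀ z ∈ p.support, G.ConnIn ((S ∪ S' ∪ {z | z ∈ p.support}) \ {c}) z a :=
    fun z hz => (ConnIn.of_mem_support (p := p) (fun w hw => hsubp c ⟨hw, hne w hw⟩) hz).symm
  have hdiff : ∀ v, v ≠ c → ∀ x ∈ S ∪ S' ∪ {z | z ∈ p.support}, x ≠ v →
      G.ConnIn ((S ∪ S' ∪ {z | z ∈ p.support}) \ {v}) x c := by
    rintro v hv x ((hx | hx) | hx) hxv
    · exact (hS.conn_diff v x hx c hc hxv hv.symm).mono (hsub v)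
    · exact (hS'.conn_diff v x hx c hc' hxv hv.symm).mono (hsub' v)
    · rcases hp.connIn_avoid hx hxv with h | h
      · exact (h.mono (hsubp v)).trans
          ((hS.conn_diff v a ha c hc h.right_mem.2 hv.symm).mono (hsub v))
      · exact (h.mono (hsubp v)).trans
          ((hS'.conn_diff v b hb c hc' h.right_mem.2 hv.symm).mono (hsub' v))
  refine .of_hubs ⟨c, ?_⟩ fun v => ?_
  · rintro x ((hx | hx) | hx)
    · exact (hS.conn x hx c hc).mono (Set.subset_union_left.trans Set.subset_union_left)
    · exact (hS'.conn x hx c hc').mono (Set.subset_union_right.trans Set.subset_union_left)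
    · exact ((hpa x hx).mono Set.sdiff_subset).trans
        ((hS.conn a ha c hc).mono (Set.subset_union_left.trans Set.subset_union_left))
  · by_cases hv : v = c
    · subst hv
      refine ⟨a, ?_⟩
      rintro x ((hx | hx) | hx) hxv
      · exact (hS.conn_diff v x hx a ha hxv hac).mono (hsub v)
      · exact ((hS'.conn_diff v x hx b hb hxv hbc).mono (hsub' v)).trans
          (hpa b p.end_mem_support)
      · exact hpa x hx
    · exact ⟨c, hdiff v hv⟩

/-- A path between two vertices of a maximal biconnected set stays in the set. -/
theorem support_subset_of_maximal (hS : Maximal G.IsBiconnectedSet S) (ha : a ∈ S) (hb : b ∈ S)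
    (hab : a ≠ b) {p : G.Walk a b} (hp : p.IsPath) (hz : x ∈ p.support) : x ∈ S :=
  hS.le_of_ge (hS.prop.union_path ha hb hab hp) Set.subset_union_left (.inr hz)

/-- By maximality `S` absorbs every path between two of its vertices; deleting vertices from the
graph thus separates vertices of `S` just as it does inside `S`. -/
theorem ConnIn.inter_of_maximal (hS : Maximal G.IsBiconnectedSet S) (ha : a ∈ S) (hb : b ∈ S)
    (h : G.ConnIn A a b) : G.ConnIn (S ∩ A) a b := by
  by_cases hab : a = b
  · subst hab
    exact .refl ⟨ha, h.left_mem⟩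
  · obtain ⟨p, hp, hpA⟩ := h.exists_isPath
    exact ⟨p, fun z hz => ⟨support_subset_of_maximal hS ha hb hab hp hz, hpA z hz⟩⟩

/-- Blocks through `c` that are linked around `c` form, with the link, a biconnected set containing
both. -/
theorem eq_of_maximal_of_connIn (hS : Maximal G.IsBiconnectedSet S)
    (hS' : Maximal G.IsBiconnectedSet S') (hc : c ∈ S) (hc' : c ∈ S') (ha : a ∈ S) (hb : b ∈ S')
    (h : G.ConnIn {c}ᶜ a b) : S = S' := by
  obtain ⟨p, hp, hpc⟩ := h.exists_isPath
  have hU := hS.prop.union_union_path hS'.prop hc hc' ha hb hp fun h => hpc c h rfl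
  exact (hS.eq_of_le hU (Set.subset_union_left.trans Set.subset_union_left)).trans
    (hS'.eq_of_le hU (Set.subset_union_right.trans Set.subset_union_left)).symm

/-- A full bridge would contain a path from `u` to `v` with an interior vertex, and maximality would
put that vertex into `S`. -/
theorem numFullBridges_pair_eq_zero [DecidableEq V] (hS : Maximal G.IsBiconnectedSet S)
    (hu : u ∈ S) (hv : v ∈ S) (huv : u ≠ v) (hne : S \ {u, v} = ∅) :
    G.numFullBridges {u, v} = 0 := by
  rw [numFullBridges, Nat.card_eq_zero]
  left
  refine ⟨fun ⟨C, hC⟩ => ?_⟩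
  obtain ⟨-, z, hz, huz⟩ := hC (a := u) (by simp)
  obtain ⟨-, w, hw, hvw⟩ := hC (a := v) (by simp)
  rw [ConnectedComponent.mem_supp_iff] at hz hw
  have hzw := ConnIn.of_reachable_induce (ConnectedComponent.eq.1 (hz.trans hw.symm))
  have hnotin : ∀ t : ↥((({u, v} : Finset V) : Set V)ᶜ), (t : V) ≠ u ∧ (t : V) ≠ v := by
    intro t
    have := t.2
    simpa using this
  have hmono : (({u, v} : Finset V) : Set V)ᶜ ⊆ {u}ᶜ := fun t ht h => ht (by simp_all)
  have hzv : G.ConnIn {u}ᶜ z v :=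
    (hzw.mono hmono).trans (.of_adj (hnotin w).1 huv.symm hvw.symm)
  obtain ⟨p, hp, hpu⟩ := hzv.exists_isPath
  have hpath : (Walk.cons huz p).IsPath := hp.cons fun h => hpu u h rfl
  have hzS : (z : V) ∈ S := support_subset_of_maximal hS hu hv huv hpath (by simp)
  have : (z : V) ∈ S \ {u, v} := ⟨hzS, by simpa using hnotin z⟩
  rw [hne] at this
  exact this

theorem numComponents_le_one_iff [Finite V] : G.numComponents ≤ 1 ↔ G.Preconnected := by
  rw [numComponents, Finite.card_le_one_iff_subsingleton]
  exact ⟨fun h x y => ConnectedComponent.eq.1 (Subsingleton.elim _ _),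
    fun h => h.subsingleton_connectedComponent⟩

theorem Connected.numComponents_eq_one (h : G.Connected) : G.numComponents = 1 := by
  have : Subsingleton G.ConnectedComponent := h.preconnected.subsingleton_connectedComponent
  have : Nonempty G.ConnectedComponent := h.nonempty.map G.connectedComponentMk
  exact Nat.card_unique

variable [Finite V]

theorem IsBiconnectedSet.isBlockGraph_induce (hS : G.IsBiconnectedSet S) (hne : S.Nonempty) :
    (G.induce S).IsBlockGraph := by
  have hconn := ConnIn.induce_connected hne hS.conn
  refine ⟨hconn, fun v hv => ?_⟩
  rw [IsCutvertex, hconn.numComponents_eq_one] at hv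
  refine hv.not_ge (numComponents_le_one_iff.2 ?_)
  rintro ⟨x, hx⟩ ⟨y, hy⟩
  have h := hS.conn_diff v x x.2 y y.2 (fun h => hx (Subtype.ext h)) (fun h => hy (Subtype.ext h))
  have h1 := h.induce_preimage (S := S) Set.sdiff_subset
  have h2 : (G.induce S).ConnIn {v}ᶜ x y :=
    h1.mono fun z hz hzv => hz.2 (congrArg Subtype.val hzv)
  exact h2.reachable_induce

theorem IsBlockGraph.isBiconnectedSet {B : G.Subgraph} (hB : B.coe.IsBlockGraph) :
    G.IsBiconnectedSet B.verts := by
  have hconn : ∀ x ∈ B.verts, ∀ y ∈ B.verts, G.ConnIn B.verts x y := by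
    intro x hx y hy
    obtain ⟨p⟩ := hB.1.preconnected ⟨x, hx⟩ ⟨y, hy⟩
    exact ConnIn.map (D := Set.univ) ⟨p, by simp⟩ B.hom fun w _ => w.2
  refine ⟨hconn, fun v x hx y hy hxv hyv => ?_⟩
  by_cases hv : v ∈ B.verts
  · have h := hB.2 ⟨v, hv⟩
    rw [IsCutvertex, hB.1.numComponents_eq_one, not_lt] at h
    have h := numComponents_le_one_iff.1 h ⟨⟨x, hx⟩, fun h => hxv (congrArg Subtype.val h)⟩
      ⟨⟨y, hy⟩, fun h => hyv (congrArg Subtype.val h)⟩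
    exact (ConnIn.of_reachable_induce h).map B.hom fun w hw =>
      ⟨w.2, fun h => hw (Subtype.ext h)⟩
  · rw [Set.sdiff_singleton_eq_self hv]
    exact hconn x hx y hy

theorem isBlockGraph_coe_induce (hS : G.IsBiconnectedSet S) (hne : S.Nonempty) :
    ((⊤ : G.Subgraph).induce S).coe.IsBlockGraph := by
  have := hS.isBlockGraph_induce hne
  rwa [induce_eq_coe_induce_top] at this

/-- The vertex set of a block is a maximal biconnected set. -/
theorem IsBlockOf.maximal_verts {B : G.Subgraph} (hB : G.IsBlockOf B) :
    Maximal G.IsBiconnectedSet B.verts := by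
  refine ⟨hB.prop.isBiconnectedSet, fun S hS hle => ?_⟩
  have hne : S.Nonempty := by
    obtain ⟨x⟩ := hB.prop.1.nonempty
    exact ⟨x, hle x.2⟩
  exact (hB.le_of_ge (isBlockGraph_coe_induce hS hne)
    ⟨hle, fun x y hxy => ⟨hle hxy.fst_mem, hle hxy.snd_mem, hxy.adj_sub⟩⟩).1

theorem IsBlockOf.eq_of_verts_eq {B B' : G.Subgraph} (hB : G.IsBlockOf B) (hB' : G.IsBlockOf B')
    (h : B.verts = B'.verts) : B = B' := by
  have hne : B.verts.Nonempty := by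
    obtain ⟨x⟩ := hB.prop.1.nonempty
    exact ⟨x, x.2⟩
  have hbl := isBlockGraph_coe_induce hB.maximal_verts.prop hne
  refine (hB.eq_of_le hbl ?_).trans (hB'.eq_of_le hbl ?_).symm
  · exact ⟨le_rfl, fun x y hxy => ⟨hxy.fst_mem, hxy.snd_mem, hxy.adj_sub⟩⟩
  · exact ⟨h.ge, fun x y hxy => ⟨h ▸ hxy.fst_mem, h ▸ hxy.snd_mem, hxy.adj_sub⟩⟩

/-- Every edge lies in a block. -/
theorem exists_block_of_adj (h : G.Adj a b) : ∃ B : G.BlockOf, a ∈ B.1.verts ∧ b ∈ B.1.verts := by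
  obtain ⟨B, hle, hB⟩ := (Set.toFinite {H : G.Subgraph | H.coe.IsBlockGraph}).exists_le_maximal
    (isBlockGraph_coe_induce (IsBiconnectedSet.pair h) ⟨a, by simp⟩)
  exact ⟨⟨B, hB⟩, hle.1 (by simp), hle.1 (by simp)⟩

/-- Each piece is attached to both `u` and `v`, and distinct pieces lie in distinct components of G
- {u, v}, since paths between them would stay in `S`. -/
theorem card_le_numFullBridges [DecidableEq V] (hS : Maximal G.IsBiconnectedSet S)
    (𝒳 : Finset (Set V)) (h𝒳 : ∀ X ∈ 𝒳, G.IsPiece S u v X) :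
    𝒳.card ≤ G.numFullBridges {u, v} := by
  classical
  have hsub : ∀ X ∈ 𝒳, X ⊆ (({u, v} : Finset V) : Set V)ᶜ := fun X hX z hz h =>
    ((h𝒳 X hX).subset hz).2 (by simpa using h)
  choose a ha using fun X : 𝒳 => (h𝒳 X X.2).nonempty
  let comp (X : 𝒳) := (G.minusVerts (({u, v} : Finset V) : Set V)).connectedComponentMk
    ⟨a X, hsub X X.2 (ha X)⟩
  have hfull : ∀ X, (({u, v} : Finset V) : Set V) ⊆ G.attachments _ (comp X) := by
    intro X w hw
    obtain ⟨z, hz, hwz⟩ : ∃ z ∈ X.1, G.Adj w z := by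
      have hw' : w = u ∨ w = v := by simpa using hw
      rcases hw' with rfl | rfl
      exacts [(h𝒳 X X.2).exists_adj_left hS.prop, (h𝒳 X X.2).exists_adj_right hS.prop]
    refine ⟨hw, ⟨z, hsub X X.2 hz⟩, ?_, hwz⟩
    rw [ConnectedComponent.mem_supp_iff, ConnectedComponent.eq]
    exact (((h𝒳 X X.2).conn z hz _ (ha X)).mono (hsub X X.2)).reachable_induce
  have hinj : Function.Injective fun X : 𝒳 =>
      (⟨comp X, hfull X⟩ : {C : (G.minusVerts (({u, v} : Finset V) : Set V)).ConnectedComponent //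
        (({u, v} : Finset V) : Set V) ⊆ G.attachments _ C}) := by
    intro X Y hXY
    have h := ConnIn.of_reachable_induce (ConnectedComponent.eq.1 (congrArg Subtype.val hXY))
    have hX := h𝒳 X X.2
    have hY := h𝒳 Y Y.2
    have h := h.inter_of_maximal hS (hX.subset (ha X)).1 (hY.subset (ha Y)).1
    refine Subtype.ext (hX.eq_of_mem hY (x := a Y) ?_ (ha Y))
    rw [hX.eq_class (ha X)]
    refine h.mono fun z hz => ⟨hz.1, fun hzu => hz.2 ?_⟩
    simpa using hzu
  have := Nat.card_le_card_of_injective _ hinj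
  rwa [Nat.card_eq_fintype_card, Fintype.card_coe] at this

open Classical in
/-- The charges of nontrivial 2-cuts to their elements. -/
noncomputable def n2cCharge (G : SimpleGraph V) (ω : Finset V → V → ℕ) (F : Finset V) (y : V) : ℕ :=
  if G.IsN2C F ∧ y ∈ F then ω F y else 0

/-- For an N2C the charges sum to c(G, uv) - 2; any other pair has at most two full bridges, so it
needs no charge. -/
theorem isChargeOn_n2cCharge [DecidableEq V] (hS : Maximal G.IsBiconnectedSet S)
    {ω : Finset V → V → ℕ}
    (hω : ∀ u v : V, u ≠ v → G.IsN2C {u, v} →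
      (ω {u, v} u : ℤ) + (ω {u, v} v : ℤ) = (G.numFullBridges {u, v} : ℤ) - 2) :
    G.IsChargeOn S (n2cCharge G ω) := by
  refine ⟨fun F y hy => by simp [n2cCharge, hy], fun u v 𝒳 h𝒳 => ?_⟩
  rcases 𝒳.eq_empty_or_nonempty with rfl | ⟨X, hX⟩
  · simp
  have huv := (h𝒳 X hX).ne
  have hcard := card_le_numFullBridges hS 𝒳 h𝒳
  by_cases hF : G.IsN2C {u, v}
  · have := hω u v huv hF
    simp only [n2cCharge, hF, true_and, Finset.mem_insert, Finset.mem_singleton, true_or, or_true,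
      if_true]
    omega
  · have : ¬ 3 ≤ G.numFullBridges {u, v} := fun h => hF ⟨Finset.card_pair huv, h⟩
    omega

/-- The spanning subgraph of a block with root edge `rs`. -/
theorem exists_block_subgraph {V : Type*} [Fintype V] [DecidableEq V] {G : SimpleGraph V}
    {S : Set V} {r s : V} {Ω : Finset V → V → ℕ} (hS : Maximal G.IsBiconnectedSet S)
    (hG : G.K4MinorFree) (hΩ : G.IsChargeOn S Ω) (hr : r ∈ S) (hs : s ∈ S) (hrs : G.Adj r s)
    (hc : G.numFullBridges {r, s} ≤ 1) :
    ∃ T ≤ G, (∀ y ∈ S, T.Reachable r y) ∧ (G.numFullBridges {r, s} = 1 → ¬ T.Adj r s) ∧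
      ∀ y, T.deg y ≤ allowance r s (S \ {r, s}) 1 1 y + regionWeight Ω r s (S \ {r, s}) y := by
  classical
  have hmem : ∀ y ∈ S, y = r ∨ y = s ∨ y ∈ S \ {r, s} := by
    intro y hy
    by_cases h1 : y = r
    · exact .inl h1
    · by_cases h2 : y = s
      · exact .inr (.inl h2)
      · exact .inr (.inr ⟨hy, by simp [h1, h2]⟩)
  rcases (S \ {r, s}).eq_empty_or_nonempty with he | ⟨w, hw⟩
  · have hz := numFullBridges_pair_eq_zero hS hr hs hrs.ne he
    obtain ⟨T, h1, h2, h3, h4⟩ := Joins.of_adj (G := G) hrs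
      (d := fun y => allowance r s (S \ {r, s}) 1 1 y + regionWeight Ω r s (S \ {r, s}) y)
      (by simp [allowance]; omega) (by simp [allowance]; omega)
    refine ⟨T, h1, fun y hy => ?_, fun h => by omega, h4⟩
    rcases hmem y hy with rfl | rfl | h
    · exact .refl _
    · exact h3
    · rw [he] at h
      exact h.elim
  · have hp := IsPiece.of_mem (G := G) hr hs hrs.ne hw
    -- A second piece would be a second full bridge, against `hc`.
    have hX : {z | G.ConnIn (S \ {r, s}) w z} = S \ {r, s} := by
      refine Set.Subset.antisymm hp.subset fun z hz => ?_
      have hp' := IsPiece.of_mem (G := G) hr hs hrs.ne hz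
      by_contra hne
      have := card_le_numFullBridges hS
        {{z | G.ConnIn (S \ {r, s}) w z}, {x | G.ConnIn (S \ {r, s}) z x}}
        (u := r) (v := s) (by
          intro X hX
          rw [Finset.mem_insert, Finset.mem_singleton] at hX
          rcases hX with rfl | rfl
          exacts [hp, hp'])
      rw [Finset.card_pair fun h => hne (by rw [h]; exact .refl hz)] at this
      omega
    rw [hX] at hp
    obtain ⟨T, h1, h2, h3, h4⟩ := (hp.joins_and_covers hS.prop hG hΩ
      (.of_adj hp.left_notMem hp.right_notMem hrs)).1
    refine ⟨T, h1.trans (deleteEdges_le _), fun y hy => ?_, fun _ h => ?_, fun y => ?_⟩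
    · rcases hmem y hy with rfl | rfl | h
      exacts [.refl _, h3, h2 y h]
    · have := h1 h
      simp [deleteEdges_adj] at this
    · have := pieceWeight_add_le_regionWeight (Ω := Ω) (X := S \ {r, s}) hrs.ne y
      refine (h4 y).trans ?_
      dsimp only
      omega

end Blocks

/-! ### The block-cutvertex tree -/

section BlockTree

variable {V : Type*} {G : SimpleGraph V}

theorem BlockOf.eq_of_connIn [Finite V] {B B' : G.BlockOf} {a b c : V} (hc : c ∈ B.1.verts)
    (hc' : c ∈ B'.1.verts) (ha : a ∈ B.1.verts) (hb : b ∈ B'.1.verts) (h : G.ConnIn {c}ᶜ a b) :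
    B = B' :=
  Subtype.ext (B.2.eq_of_verts_eq B'.2
    (eq_of_maximal_of_connIn B.2.maximal_verts B'.2.maximal_verts hc hc' ha hb h))

theorem BlockOf.eq_of_mem [Finite V] {B B' : G.BlockOf} {a b : V} (hab : a ≠ b)
    (ha : a ∈ B.1.verts) (ha' : a ∈ B'.1.verts) (hb : b ∈ B.1.verts) (hb' : b ∈ B'.1.verts) :
    B = B' :=
  eq_of_connIn ha ha' hb hb' (.refl hab.symm)

variable [Finite V] (hG : G.Connected) (hB : ∀ (B : G.BlockOf) (c : V), ∃ b ∈ B.1.verts, b ≠ c)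

-- Blocks through `c` have further vertices, and these lie in different components of G - c for
-- different blocks.
include hB in
theorem card_blocks_le_numComponents (c : V) (I : Finset G.BlockOf)
    (hI : ∀ B ∈ I, c ∈ B.1.verts) : I.card ≤ (G.minusVerts {c}).numComponents := by
  choose b hb hbc using fun B : I => hB B c
  have hinj : Function.Injective fun B : I =>
      (G.minusVerts {c}).connectedComponentMk ⟨b B, hbc B⟩ := by
    intro B B' h
    have h := ConnIn.of_reachable_induce (ConnectedComponent.eq.1 h)
    exact Subtype.ext (BlockOf.eq_of_connIn (hI B B.2) (hI B' B'.2) (hb B) (hb B') h)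
  have := Nat.card_le_card_of_injective _ hinj
  rwa [Nat.card_eq_fintype_card, Fintype.card_coe] at this

include hG hB in
theorem isCutvertex_of_mem_of_mem {B B' : G.BlockOf} (hne : B ≠ B') {c : V}
    (hc : c ∈ B.1.verts) (hc' : c ∈ B'.1.verts) : G.IsCutvertex c := by
  classical
  rw [IsCutvertex, hG.numComponents_eq_one]
  have := card_blocks_le_numComponents hB c {B, B'} (by simp [hc, hc'])
  rwa [Finset.card_pair hne] at this

-- Every edge `Bc` is a bridge. A walk from `B` that avoids this edge only meets blocks and
-- cutvertices on the side of G - c containing the rest of `B`: entering `c` from a block on that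
-- side would force the block to be `B`.
include hB in
theorem isAcyclic_blockCutvertexTree : G.blockCutvertexTree.IsAcyclic := by
  have key : ∀ (B : G.BlockOf) (c : G.CutvertexOf), c.1 ∈ B.1.verts →
      ¬ (G.blockCutvertexTree.deleteEdges {s(Sum.inl B, Sum.inr c)}).Reachable
        (Sum.inl B) (Sum.inr c) := by
    rintro B c hc ⟨p⟩
    obtain ⟨b, hb, hbc⟩ := hB B c.1
    let P : Set (G.BlockOf ⊕ G.CutvertexOf) := {t | Sum.elim
      (fun B' => ∀ z ∈ B'.1.verts, z ≠ c.1 → G.ConnIn {c.1}ᶜ b z)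
      (fun c' => G.ConnIn {c.1}ᶜ b c'.1) t}
    have hmono : ∀ B' : G.BlockOf, B'.1.verts \ {c.1} ⊆ {c.1}ᶜ := fun _ _ h => h.2
    have hstart : Sum.inl B ∈ P := fun z hz hzc =>
      (B.2.maximal_verts.prop.conn_diff c.1 b hb z hz hbc hzc).mono (hmono B)
    have hend : Sum.inr c ∈ P := by
      refine ConnIn.closed (A := Set.univ) ⟨p, by simp⟩ hstart ?_
      rintro (B' | c') ht (B'' | c'') - hadj <;> rw [deleteEdges_adj] at hadj
      · exact hadj.1.elim
      · have hmem : c''.1 ∈ B'.1.verts := hadj.1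
        refine ht c''.1 hmem fun heq => hadj.2 ?_
        obtain ⟨b', hb', hbc'⟩ := hB B' c.1
        have hBB : B = B' := BlockOf.eq_of_connIn hc (heq ▸ hmem) hb hb' (ht b' hb' hbc')
        have hcc : c'' = c := Subtype.ext heq
        rw [hBB, hcc]
        rfl
      · have hmem : c'.1 ∈ B''.1.verts := hadj.1
        intro z hz hzc
        have ht : G.ConnIn {c.1}ᶜ b c'.1 := ht
        exact ht.trans ((B''.2.maximal_verts.prop.conn_diff c.1 _ hmem z hz ht.right_mem hzc).mono
          (hmono B''))
      · exact hadj.1.elim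
    exact (show G.ConnIn {c.1}ᶜ b c.1 from hend).right_mem rfl
  rw [isAcyclic_iff_forall_adj_isBridge]
  rintro (B | c) (B' | c') h
  · exact h.elim
  · exact isBridge_iff.2 (key B c' h)
  · rw [Sym2.eq_swap]
    exact isBridge_iff.2 (key B' c h)
  · exact h.elim

include hG hB in
/-- Every vertex `v` lies in at most one block that is not rooted at `v`. -/
theorem eq_of_not_isRootVertex {B₀ B B' : G.BlockOf} {v : V} (hv : v ∈ B.1.verts)
    (hv' : v ∈ B'.1.verts)
    (h : ∃ p : G.blockCutvertexTree.Walk (Sum.inl B₀) (Sum.inl B), p.IsPath ∧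
      ∀ c : G.CutvertexOf, p.penultimate = Sum.inr c → c.1 ≠ v)
    (h' : ∃ p : G.blockCutvertexTree.Walk (Sum.inl B₀) (Sum.inl B'), p.IsPath ∧
      ∀ c : G.CutvertexOf, p.penultimate = Sum.inr c → c.1 ≠ v) : B = B' := by
  by_contra hne
  let c : G.CutvertexOf := ⟨v, isCutvertex_of_mem_of_mem hG hB hne hv hv'⟩
  have hac := isAcyclic_blockCutvertexTree hB
  have key : ∀ {B : G.BlockOf}, v ∈ B.1.verts →
      (∃ p : G.blockCutvertexTree.Walk (Sum.inl B₀) (Sum.inl B), p.IsPath ∧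
        ∀ c : G.CutvertexOf, p.penultimate = Sum.inr c → c.1 ≠ v) →
      ∃ q : G.blockCutvertexTree.Walk (Sum.inl B₀) (Sum.inr c), q.IsPath ∧
        q.penultimate = Sum.inl B := by
    rintro B hv ⟨p, hp, hpen⟩
    have hadj : G.blockCutvertexTree.Adj (Sum.inl B) (Sum.inr c) := hv
    refine ⟨p.concat hadj, hp.concat (fun hmem => ?_) hadj, Walk.penultimate_concat _ _⟩
    -- In an acyclic graph a neighbour of the last vertex that lies on the path must be the
    -- penultimate one. So both paths extend to `c`, and uniqueness of the path to `c` identifies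
    -- the two blocks.
    exact hpen c (hac.eq_penultimate_of_adj_end hp hadj hmem).symm rfl
  obtain ⟨q, hq, hqB⟩ := key hv h
  obtain ⟨q', hq', hqB'⟩ := key hv' h'
  have := (hac.subsingleton_path _ _).elim ⟨q, hq⟩ ⟨q', hq'⟩
  have hqq : q = q' := congrArg Subtype.val this
  rw [hqq, hqB'] at hqB
  exact hne (Sum.inl.inj hqB).symm

end BlockTree

/-! ### Summation over the blocks -/

section Sums

variable {V ι : Type*} [Fintype ι]

theorem deg_iSup_le [Finite V] (T : ι → SimpleGraph V) (v : V) :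
    (⨆ i, T i).deg v ≤ ∑ i, (T i).deg v := by
  rw [deg, neighborSet_iSup]
  exact Set.ncard_iUnion_le_of_fintype _

theorem sum_weight_le [Fintype V] (Ω : Finset V → V → ℕ) (P : ι → Finset V → Prop)
    (hP : ∀ i j F, P i F → P j F → i = j) (y : V) :
    ∑ i, weight Ω (P i) y ≤ ∑ F, Ω F y := by
  classical
  unfold weight
  rw [← Finset.sum_biUnion]
  · exact Finset.sum_le_sum_of_subset (Finset.subset_univ _)
  · intro i _ j _ hij
    refine Finset.disjoint_left.2 fun F hF hF' => hij ?_
    simp only [Finset.mem_filter] at hF hF'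
    exact hP i j F hF.2 hF'.2

open Classical in
theorem sum_allowance_le (S : ι → Set V) (r s : ι → V) (hr : ∀ i, r i ∈ S i) (hs : ∀ i, s i ∈ S i)
    (hrs : ∀ i, r i ≠ s i) (v : V) :
    ∑ i, allowance (r i) (s i) (S i \ {r i, s i}) 1 1 v ≤
      ({i | v ∈ S i} : Finset ι).card + ({i | v ∈ S i ∧ v ≠ r i ∧ v ≠ s i} : Finset ι).card := by
  rw [Finset.card_filter, Finset.card_filter, ← Finset.sum_add_distrib]
  refine Finset.sum_le_sum fun i _ => ?_
  by_cases h1 : v = r i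
  · subst h1
    simp [allowance, hr, hrs]
  · by_cases h2 : v = s i
    · subst h2
      simp [allowance, hs, h1]
    · by_cases h3 : v ∈ S i <;> simp [allowance, h1, h2, h3]

end Sums

end SimpleGraph

open SimpleGraph

/-! ### Assembling the spanning tree -/

theorem mainTheorem4 {V : Type*} [Fintype V] [DecidableEq V] (G : SimpleGraph V)
    (hconn : G.Connected) (hK4 : G.K4MinorFree) (hcard : 2 ≤ Fintype.card V)
    (f : V → ℤ) (hf : ∀ v, 2 ≤ f v)
    (ω : Finset V → V → ℕ)
    (hω : ∀ u v : V, u ≠ v → G.IsN2C {u, v} →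
      (ω {u, v} u : ℤ) + (ω {u, v} v : ℤ) = (G.numFullBridges {u, v} : ℤ) - 2)
    (hωf : ∀ u : V,
      (∑ F ∈ G.n2csAt u, (ω F u : ℤ)) + ((G.minusVerts {u}).numComponents : ℤ) - 1 ≤ f u - 2)
    (k : ℕ) (B : Fin (k + 1) ≃ G.BlockOf) (r s : Fin (k + 1) → V)
    (hrs : ∀ i, (B i).1.Adj (r i) (s i))
    (hc : ∀ i, G.numFullBridges {r i, s i} ≤ 1)
    (hr : ∀ i, i ≠ 0 → G.IsRootVertex (B 0) (B i) (r i)) :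
    ∃ T : SimpleGraph V, T ≤ G ∧ T.IsTree ∧
      (∀ v, (T.deg v : ℤ) ≤ f v) ∧
      (T.deg (r 0) : ℤ) ≤ f (r 0) - 1 ∧
      (∀ i, (T.deg (s i) : ℤ) ≤ f (s i) - 1) ∧
      (∀ i, (G.numFullBridges {r i, s i} = 0 → T.Adj (r i) (s i)) ∧
        (G.numFullBridges {r i, s i} = 1 → ¬ T.Adj (r i) (s i))) := by
  classical
  have hS : ∀ i, Maximal G.IsBiconnectedSet (B i).1.verts := fun i => (B i).2.maximal_verts
  have hrS : ∀ i, r i ∈ (B i).1.verts := fun i => (hrs i).fst_mem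
  have hsS : ∀ i, s i ∈ (B i).1.verts := fun i => (hrs i).snd_mem
  have hadj : ∀ i, G.Adj (r i) (s i) := fun i => (hrs i).adj_sub
  have hB : ∀ (b : G.BlockOf) (c : V), ∃ z ∈ b.1.verts, z ≠ c := by
    intro b c
    obtain ⟨i, rfl⟩ := B.surjective b
    by_cases h : r i = c
    exacts [⟨s i, hsS i, h ▸ (hadj i).ne'⟩, ⟨r i, hrS i, h⟩]
  set Ω := n2cCharge G ω
  have hΩ : ∀ i, G.IsChargeOn (B i).1.verts Ω := fun i => isChargeOn_n2cCharge (hS i) hω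
  choose T hTG hTreach hTnot hTdeg using fun i =>
    exists_block_subgraph (hS i) hK4 (hΩ i) (hrS i) (hsS i) (hadj i) (hc i)
  have huniq : ∀ (i j : Fin (k + 1)) (a b : V), a ≠ b → a ∈ (B i).1.verts → a ∈ (B j).1.verts →
      b ∈ (B i).1.verts → b ∈ (B j).1.verts → i = j := fun i j a b hab h1 h2 h3 h4 =>
    B.injective (BlockOf.eq_of_mem hab h1 h2 h3 h4)
  have hsets : ∀ i, (B i).1.verts \ {r i, s i} ∪ {r i, s i} = (B i).1.verts := fun i =>
    Set.sdiff_union_of_subset (by rintro z (rfl | rfl); exacts [hrS i, hsS i])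
  -- The budget vanishes outside the block, so `T i` has no edges leaving it.
  have hsupp : ∀ i v, v ∉ (B i).1.verts → (T i).deg v = 0 := by
    intro i v hv
    have h := hTdeg i v
    rw [regionWeight_eq_zero (hΩ i).eq_zero (by rwa [hsets i])] at h
    have hvr : v ≠ r i := fun h => hv (h ▸ hrS i)
    have hvs : v ≠ s i := fun h => hv (h ▸ hsS i)
    simpa [allowance, hv, hvr, hvs] using h
  have hroot : ∀ (v : V) (i j : Fin (k + 1)), v ∈ (B i).1.verts → v ∈ (B j).1.verts →
      (i = 0 ∨ v ≠ r i) → (j = 0 ∨ v ≠ r j) → i = j := by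
    intro v i j hi hj hi' hj'
    have key : ∀ i, (i = 0 ∨ v ≠ r i) →
        ∃ p : G.blockCutvertexTree.Walk (Sum.inl (B 0)) (Sum.inl (B i)), p.IsPath ∧
          ∀ c : G.CutvertexOf, p.penultimate = Sum.inr c → c.1 ≠ v := by
      intro i hi
      by_cases h0 : i = 0
      · subst h0
        -- The trivial walk has `B 0` itself as its penultimate vertex, so the root block counts as
        -- not rooted at any `v`.
        exact ⟨.nil, .nil, fun c hc => absurd hc (by simp)⟩
      · obtain ⟨c, hcr, p, hp, hpen⟩ := hr i h0
        refine ⟨p, hp, fun c' hc' => ?_⟩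
        rw [hpen] at hc'
        rw [← Sum.inr.inj hc', hcr]
        exact (hi.resolve_left h0).symm
    exact B.injective (eq_of_not_isRootVertex hconn hB hi hj (key i hi') (key j hj'))
  have hweight : ∀ v, ∑ i, regionWeight Ω (r i) (s i) ((B i).1.verts \ {r i, s i}) v ≤
      ∑ F ∈ G.n2csAt v, ω F v := by
    intro v
    refine (sum_weight_le Ω _ ?_ v).trans (le_of_eq ?_)
    · rintro i j F ⟨h1, h2⟩ ⟨-, h3⟩
      rw [hsets] at h2 h3
      obtain ⟨a, b, hab, rfl⟩ := Finset.card_eq_two.1 h1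
      exact huniq i j a b hab (h2 (by simp)) (h3 (by simp)) (h2 (by simp)) (h3 (by simp))
    · rw [n2csAt, Finset.sum_filter]
      rfl
  have hblocks : ∀ v, ({i | v ∈ (B i).1.verts} : Finset (Fin (k + 1))).card ≤
      (G.minusVerts {v}).numComponents := by
    intro v
    have := card_blocks_le_numComponents hB v
      (({i | v ∈ (B i).1.verts} : Finset (Fin (k + 1))).map B.toEmbedding) (by simp)
    rwa [Finset.card_map] at this
  -- Each block through `v` contributes 1, and one more where `v` is not an end of the root edge;
  -- `hωf` absorbs everything but the latter.
  have hdeg : ∀ v, ((⨆ i, T i).deg v : ℤ) ≤ f v - 1 +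
      ({i | v ∈ (B i).1.verts ∧ v ≠ r i ∧ v ≠ s i} : Finset (Fin (k + 1))).card := by
    intro v
    have h1 := (deg_iSup_le T v).trans (Finset.sum_le_sum fun i _ => hTdeg i v)
    rw [Finset.sum_add_distrib] at h1
    have h2 : ∑ i, allowance (r i) (s i) ((B i).1.verts \ {r i, s i}) 1 1 v ≤
        ({i | v ∈ (B i).1.verts} : Finset (Fin (k + 1))).card +
          ({i | v ∈ (B i).1.verts ∧ v ≠ r i ∧ v ≠ s i} : Finset (Fin (k + 1))).card := by
      convert sum_allowance_le (fun i => (B i).1.verts) r s hrS hsS (fun i => (hadj i).ne) v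
    have h3 := hweight v
    have h4 := hblocks v
    have h5 := hωf v
    rw [← Nat.cast_sum] at h5
    omega
  have hdeg' : ∀ v, (∀ i, v ∈ (B i).1.verts → v ≠ r i → v = s i) →
      ((⨆ i, T i).deg v : ℤ) ≤ f v - 1 := by
    intro v hv
    have h := hdeg v
    rwa [Finset.filter_false_of_mem (by rintro i - ⟨h1, h2, h3⟩; exact h3 (hv i h1 h2)),
      Finset.card_empty, Nat.cast_zero, add_zero] at h
  have hTconn : (⨆ i, T i).Connected := by
    have := hconn.nonempty
    refine ⟨fun x y => ?_⟩
    obtain ⟨p⟩ := hconn.preconnected x y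
    induction p with
    | nil => exact .refl _
    | @cons x z y hxz p ih =>
      refine Reachable.trans ?_ ih
      obtain ⟨b, hx, hz⟩ := exists_block_of_adj hxz
      obtain ⟨i, rfl⟩ := B.surjective b
      exact ((hTreach i x hx).symm.trans (hTreach i z hz)).mono (le_iSup T i)
  obtain ⟨T', hT', htree⟩ := hTconn.exists_isTree_le
  have hT'G : T' ≤ G := hT'.trans (iSup_le hTG)
  have hle : ∀ v, (T'.deg v : ℤ) ≤ (⨆ i, T i).deg v := fun v => by exact_mod_cast deg_mono hT' v
  refine ⟨T', hT'G, htree, fun v => ?_, ?_, fun i => ?_, fun i => ⟨fun h0 => ?_, fun h1 => ?_⟩⟩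
  · have hcard : ({i | v ∈ (B i).1.verts ∧ v ≠ r i ∧ v ≠ s i} : Finset (Fin (k + 1))).card ≤ 1 := by
      refine Finset.card_le_one.2 fun i hi j hj => ?_
      simp only [Finset.mem_filter, Finset.mem_univ, true_and] at hi hj
      exact hroot v i j hi.1 hj.1 (.inr hi.2.1) (.inr hj.2.1)
    have := hdeg v
    have := hle v
    omega
  · refine (hle _).trans (hdeg' _ fun i hi hne => ?_)
    have := hroot (r 0) i 0 hi (hrS 0) (.inr hne) (.inl rfl)
    exact absurd (by rw [this]) hne
  · refine (hle _).trans (hdeg' _ fun j hj hne => ?_)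
    rw [hroot (s i) j i hj (hsS i) (.inr hne) (.inr (hadj i).ne')]
  -- The tree path from `r i` to `s i` stays in the block. If it is not the edge itself, its second
  -- vertex lies in a piece, which gives a full bridge.
  · by_contra hnadj
    obtain ⟨p, hp⟩ := (htree.connected.preconnected (r i) (s i)).exists_isPath
    obtain ⟨z, hz, q, rfl⟩ := p.exists_eq_cons_of_ne (hadj i).ne
    have hzS : z ∈ (B i).1.verts :=
      support_subset_of_maximal (hS i) (hrS i) (hsS i) (hadj i).ne (hp.mapLe hT'G) (by simp)
    have hzrs : z ∈ (B i).1.verts \ {r i, s i} := by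
      refine ⟨hzS, ?_⟩
      rintro (rfl | rfl)
      exacts [hz.ne rfl, hnadj hz]
    have := card_le_numFullBridges (hS i) {_} (u := r i) (v := s i) fun X hX =>
      Finset.mem_singleton.1 hX ▸ IsPiece.of_mem (hrS i) (hsS i) (hadj i).ne hzrs
    rw [Finset.card_singleton] at this
    omega
  · intro h
    -- Only `T i` could contribute this edge, as no other block contains both ends.
    obtain ⟨j, hj⟩ := iSup_adj.1 (hT' h)
    have hmem : ∀ y z, (T j).Adj y z → y ∈ (B j).1.verts := fun y z hyz => by
      by_contra hy
      exact not_adj_of_deg_eq_zero (hsupp j y hy) hyz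
    have := huniq i j (r i) (s i) (hadj i).ne (hrS i) (hmem _ _ hj) (hsS i) (hmem _ _ hj.symm)
    subst this
    exact hTnot i h1 hj
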